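/- Notation. For a finite set $A$ of positive integers put $R(A)=\sum_{n\in A}1/n$ and $A_d=\{n\in A: d\mid n\}$; let $\mathcal Q_A$ be the set of prime powers $q=p^k$ ($p$ prime, $k\ge 1$) dividing at least one element of $A$, and let $Q$ be the least common multiple of the elements of $\mathcal Q_A$ (so $Q=1$ if $A=\emptyset$). $\Omega(n)$ is the number of prime factors of $n$ counted with multiplicity, and a positive integer $n$ is called $S$-smooth if every prime power $q\mid n$ satisfies $q\le S$. Proposition 5.2. There exists an absolute constant $C\ge 1$ such that the following holds. Let $\delta\in(0,1)$, $\varepsilon\in(0,1/10)$, and let the real number $N$ be sufficiently large in terms of $\varepsilon$ and $\delta$. Let $\eta,S,K,M$ be real numbers with $\eta\ge(\log N)^{-1}$ and $$N^{0.99}\le S\le K\le M\le N/10^4 .$$ Put $$\Gamma=\max\left(\frac{\eta}{(\log N)^{\delta}(\log\log N)^3},\ \frac{\eta^2(\log N)^{1-2\delta}}{(\log(N/M))^2(\log\log N)^5}\right),$$ and suppose that $$S\le\min\left(\frac{M^2}{CN},\ \frac{\eta MK^2}{N^2(\log N)^3}\right),\qquad K\le M\exp\left(-(\log N)^{1-\delta}\right),$$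 $$C\le\frac{\Gamma^2}{(\log N)^{2\varepsilon}\left(\log(N/M)+(\log N)^{1-\delta}\right)}.$$ Let $A$ be a set of integers in $[M,N]$ such that every $n\in A$ is $S$-smooth and satisfies $\Omega(n)\le 5\log\log N$, and such that $q\cdot R(A_q)\ge\eta$ for every $q\in\mathcal Q_A$. Then for every $x\in\mathbb N$ with $$\left(1+\frac1{\log N}\right)\frac xQ\ \le\ R(A)\ \le\ (\log N)\,\frac xQ$$ there exists $B\subseteq A$ with $R(B)=x/Q$. -/

import Mathlib

namespace UnitFractions

/-- The reciprocal sum `R(A)`, the sum of `1 / n` over `n ∈ A`. -/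
noncomputable def R (A : Finset ℕ) : ℝ := ∑ n ∈ A, 1 / (n : ℝ)

/-- `A_d`, the set of the elements of `A` that are divisible by `d`. -/
def multiplesIn (A : Finset ℕ) (d : ℕ) : Finset ℕ := A.filter (fun n => d ∣ n)

/-- `n` is `S`-smooth: every prime power `q` (not only every prime) dividing `n`
satisfies `q ≤ S`. -/
def IsSmooth (S : ℝ) (n : ℕ) : Prop := ∀ q : ℕ, IsPrimePow q → q ∣ n → (q : ℝ) ≤ S

/-- `𝒬_A`, the set of all prime powers `p ^ k` with `k ≥ 1` that divide at least one element
of the (finite) set `A` of positive integers. -/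
noncomputable def primePowers (A : Finset ℕ) : Finset ℕ :=
  (A.biUnion Nat.divisors).filter IsPrimePow

theorem mem_primePowers {A : Finset ℕ} (hA : 0 ∉ A) (q : ℕ) :
    q ∈ primePowers A ↔ IsPrimePow q ∧ ∃ n ∈ A, q ∣ n := by
  simp only [primePowers, Finset.mem_filter, Finset.mem_biUnion, Nat.mem_divisors]
  constructor
  · rintro ⟨⟨n, hn, hq, -⟩, hp⟩
    exact ⟨hp, n, hn, hq⟩
  · rintro ⟨hp, n, hn, hq⟩
    exact ⟨⟨n, hn, hq, fun h => hA (h ▸ hn)⟩, hp⟩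

/-- `Q = [𝒬_A]`, the least common multiple of the prime powers dividing elements of `A`. -/
noncomputable def Q (A : Finset ℕ) : ℕ := (primePowers A).lcm id

/-- The parameter `Γ`. -/
noncomputable def Gam (δ η M N : ℝ) : ℝ :=
  max (η / (Real.log N ^ δ * Real.log (Real.log N) ^ 3))
    (η ^ 2 * Real.log N ^ (1 - 2 * δ) /
      (Real.log (N / M) ^ 2 * Real.log (Real.log N) ^ 5))

end UnitFractions

/-!
Choose each `n ∈ A` independently with probability `p = x / (Q R(A))`, so that the random sum
`R(B)` has mean `x / Q`; the bounds on `R(A)` say that `1 / log N ≤ p ≤ 1 - 1 / (log N + 1)`.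
As every `n ∈ A` divides `Q`, the probability that `R(B) - x / Q` is an integer is the average over
`h` modulo `Q` of the characteristic function `F(h)`, a product over `n ∈ A` of `factor p (2πih/n)`.
If no subset has sum `x / Q`, then such an integer is nonzero, and this has probability at most
`2 exp (-M² / (4N))` by Chernoff, which is less than `1 / (2Q)` because `Q ≤ exp (6S)` by Chebyshev
and `S ≤ M² / (100 N)` (`exists_subset_of_fourier`, `sum_weight_tail_le`, `tail_lt`). It remains to
show that `Re ∑_h F(h) ≥ 1/2`.

For `|h| ≤ K / 2` (`re_sum_near_ge`), `F(0) = 1`; the centring makes the phase of each factor of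
third order in `h / n`, so that `Re F(h) ≥ 0` for `|h|` up to about `M |A|^(-1/3)`; beyond that,
`F(h)` is tiny because `|factor p (2πiθ)| ≤ exp (-8 p (1 - p) ‖θ‖²)`.

For `|h| > K / 2` (`sum_far_le`), let `D_h` be the set of those prime powers `q` for which all but
few of the `n ∈ A_q` divide an integer within `K / 2` of `h`. Each `q ∉ D_h` provides many `n` with
`‖h / n‖ > K / (2N)`, and as `Ω(n) ≤ 5 log log N` these add up to a factor
`exp (-(log N)² / (20 log log N))` in `F(h)` for each `q ∉ D_h` (`norm_prod_factor_le`). On the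
other hand there is one integer `x` within `K / 2` of `h` that is divisible by all `q ∈ D_h`
(`exists_common_multiple`), so at most `3 (K + 1) ∏_{q ∉ D} q` frequencies have `D_h = D`, and `D_h`
is never everything, since then `Q ∣ x` would force `x = 0`. Summing over `D` gives a small total
(`sum_minor_le`).

The existence of `x` is the arithmetic core. If `q ∈ D_h`, then the `n / q`, for `n ∈ A_q`
dividing a multiple `x_n` of `q` near `h`, have a large reciprocal sum. Split `n / q = a b` into
its smooth and rough parts at `z = exp (V / (10 log log N))`, with `V = (log N)^(1-δ)`. As `Ω(n)`
is small, `a` is so small that `q b > K`, whence `b` determines `x_n`; the sum over `a ∣ x_n` is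
controlled by `∏_{p ≤ z, p ∣ x_n} (1 - 1/p)⁻¹`, and a Mertens-type bound for the sum over `b`
shows that this product exceeds some `G` for one of the `x_n` (`sum_inv_divisors_le`,
`exists_multiple_smoothWeight`). The hypothesis on `Γ` makes `G²` larger than a constant times
`V`. But for two distinct integers near `h` the product of these weights is at most
`∏_{p ≤ z} (1 - 1/p)⁻¹ · ∏_{p ∣ x - y} (1 - 1/p)⁻¹`, hence of order at most `V`
(`smoothWeight_mul_le`). So all `q ∈ D_h` share the same `x`.
-/

namespace UnitFractions

open Finset

/-! ### Euler products over finite sets of primes, and reciprocal sums -/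

/-- The Euler product `∏ (1 - 1/p)⁻¹` over the primes `p` in the finite set `s`; the elements of `s`
that are not prime are ignored. -/
noncomputable def eulerProd (s : Finset ℕ) : ℝ := ∏ p ∈ s with p.Prime, (1 - (p : ℝ)⁻¹)⁻¹

theorem one_le_inv_one_sub_inv {p : ℕ} (hp : p.Prime) : 1 ≤ (1 - (p : ℝ)⁻¹)⁻¹ := by
  have h2 : (2 : ℝ) ≤ p := by exact_mod_cast hp.two_le
  have h3 : (p : ℝ)⁻¹ ≤ 2⁻¹ := inv_anti₀ (by norm_num) h2
  have h4 : 0 < (p : ℝ)⁻¹ := by positivity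
  rw [one_le_inv₀ (by linarith)]
  linarith

theorem one_le_eulerProd (s : Finset ℕ) : 1 ≤ eulerProd s := by
  unfold eulerProd
  exact Finset.one_le_prod fun p hp => one_le_inv_one_sub_inv (mem_filter.mp hp).2

theorem eulerProd_mono {s t : Finset ℕ} (h : s ⊆ t) : eulerProd s ≤ eulerProd t := by
  unfold eulerProd
  exact Finset.prod_le_prod_of_subset_of_one_le (filter_subset_filter _ h)
    (fun p hp => zero_le_one.trans (one_le_inv_one_sub_inv (mem_filter.mp hp).2))
    fun p hp _ => one_le_inv_one_sub_inv (mem_filter.mp hp).2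

/-- Primes common to `s` and `t` are counted twice on both sides; this is how the weights of two
integers are compared with the primes that they share. -/
theorem eulerProd_union_mul_inter (s t : Finset ℕ) :
    eulerProd (s ∪ t) * eulerProd (s ∩ t) = eulerProd s * eulerProd t := by
  unfold eulerProd
  rw [filter_union, filter_inter_distrib, prod_union_inter]

theorem eulerProd_union_le (s t : Finset ℕ) :
    eulerProd (s ∪ t) ≤ eulerProd s * eulerProd t := by
  rw [← eulerProd_union_mul_inter]
  exact le_mul_of_one_le_right (by linarith [one_le_eulerProd (s ∪ t)]) (one_le_eulerProd _)

theorem hasSum_rpow_factoredNumbers (s : Finset ℕ) {σ : ℝ} (hσ : 0 < σ) :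
    HasSum (fun m : Nat.factoredNumbers s => ((m : ℕ) : ℝ) ^ (-σ))
      (∏ p ∈ s with p.Prime, (1 - (p : ℝ) ^ (-σ))⁻¹) := by
  let f : ℕ →* ℝ :=
    { toFun := fun n => (n : ℝ) ^ (-σ)
      map_one' := by simp
      map_mul' := fun a b => by
        push_cast
        exact Real.mul_rpow (by positivity) (by positivity) }
  have hf : ∀ n, f n = (n : ℝ) ^ (-σ) := fun n => rfl
  have h0 : ∀ n, 0 ≤ f n := fun n => by rw [hf]; positivity
  exact (EulerProduct.summable_and_hasSum_factoredNumbers_prod_filter_prime_geometric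
    (f := f) (fun {p} hp => by
      rw [Real.norm_of_nonneg (h0 p), hf]
      exact Real.rpow_lt_one_of_one_lt_of_neg (by exact_mod_cast hp.one_lt) (by linarith)) s).2

theorem sum_inv_le_eulerProd (s F : Finset ℕ) (hF : ∀ m ∈ F, m ∈ Nat.factoredNumbers s) :
    ∑ m ∈ F, 1 / (m : ℝ) ≤ eulerProd s := by
  have key := sum_le_hasSum (F.subtype (· ∈ Nat.factoredNumbers s))
    (fun i _ => by positivity) (hasSum_rpow_factoredNumbers s one_pos)
  rw [Finset.sum_subtype_of_mem (f := fun m : ℕ => (m : ℝ) ^ (-1 : ℝ)) hF] at key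
  simpa [Real.rpow_neg_one, eulerProd] using key

/-- If `f` has sum at most `c` over each dyadic interval `[v, 2v)`, then its sum over a set inside
`[u, u e^t]` is at most `c` times the number of dyadic intervals needed to cover it. -/
theorem sum_le_of_dyadic (F : Finset ℕ) (f : ℕ → ℝ) (hf : ∀ m ∈ F, 0 ≤ f m) {u t c : ℝ}
    (hu : 0 < u) (ht : 0 ≤ t) (hF : ∀ m ∈ F, u ≤ m ∧ (m : ℝ) ≤ u * Real.exp t)
    (hc : ∀ v, u ≤ v → ∑ m ∈ F.filter (fun m : ℕ => v ≤ (m : ℝ) ∧ (m : ℝ) < 2 * v), f m ≤ c) :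
    ∑ m ∈ F, f m ≤ c * (t / Real.log 2 + 1) := by
  have hl2 : 0 < Real.log 2 := Real.log_pos (by norm_num)
  have hc0 : 0 ≤ c := le_trans (sum_nonneg fun m hm => hf m (mem_filter.mp hm).1) (hc u le_rfl)
  set j : ℕ → ℕ := fun m => ⌊Real.log (m / u) / Real.log 2⌋₊ with hj
  have hm1 : ∀ m ∈ F, 1 ≤ (m : ℝ) / u := fun m hm => by
    rw [le_div_iff₀ hu]; linarith [(hF m hm).1]
  have hmaps : ∀ m ∈ F, j m ∈ range (⌊t / Real.log 2⌋₊ + 1) := by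
    intro m hm
    rw [mem_range, Nat.lt_succ_iff]
    apply Nat.floor_le_floor
    gcongr
    rw [Real.log_le_iff_le_exp (by linarith [hm1 m hm]), div_le_iff₀ hu]
    linarith [(hF m hm).2]
  rw [← sum_fiberwise_of_maps_to hmaps]
  calc _ ≤ ∑ i ∈ range (⌊t / Real.log 2⌋₊ + 1), c := by
        apply sum_le_sum
        intro i _
        refine le_trans (sum_le_sum_of_subset_of_nonneg ?_ ?_) (hc (u * 2 ^ i) ?_)
        · intro m hm
          obtain ⟨hmF, hji⟩ := mem_filter.mp hm
          have hpos : 0 < (m : ℝ) / u := by linarith [hm1 m hmF]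
          have hlog : 0 ≤ Real.log (m / u) := Real.log_nonneg (hm1 m hmF)
          have h1 : (i : ℝ) ≤ Real.log (m / u) / Real.log 2 := by
            rw [← hji]; exact Nat.floor_le (by positivity)
          have h2 : Real.log (m / u) / Real.log 2 < i + 1 := by
            rw [← hji]; exact Nat.lt_floor_add_one _
          rw [le_div_iff₀ hl2, ← Real.log_pow, Real.log_le_log_iff (by positivity) hpos,
            le_div_iff₀ hu] at h1
          rw [div_lt_iff₀ hl2] at h2
          have h2' : Real.log (m / u) < Real.log (2 ^ (i + 1)) := by
            rw [Real.log_pow]; push_cast; linarith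
          rw [Real.log_lt_log_iff hpos (by positivity), div_lt_iff₀ hu, pow_succ] at h2'
          refine mem_filter.mpr ⟨hmF, by linarith, by linarith⟩
        · intro m hm _
          exact hf m (mem_filter.mp hm).1
        · exact le_mul_of_one_le_right hu.le (one_le_pow₀ (by norm_num))
    _ = c * (⌊t / Real.log 2⌋₊ + 1) := by simp; ring
    _ ≤ c * (t / Real.log 2 + 1) := by
        gcongr
        exact Nat.floor_le (by positivity)

/-- Chebyshev's bound in the form `∑ log p / p ≪ t + 1` over the primes in `[u, u e^t]`, uniformly
in `u`. -/
theorem sum_log_div_le (F : Finset ℕ) (hP : ∀ p ∈ F, p.Prime) {u t : ℝ} (hu : 0 < u) (ht : 0 ≤ t)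
    (hF : ∀ m ∈ F, u ≤ m ∧ (m : ℝ) ≤ u * Real.exp t) :
    ∑ p ∈ F, Real.log p / p ≤ 4 * (t + 1) := by
  have hl4 : Real.log 4 = 2 * Real.log 2 := by
    rw [show (4 : ℝ) = 2 ^ 2 by norm_num, Real.log_pow]; norm_num
  have hl2 : 0 < Real.log 2 := Real.log_pos (by norm_num)
  have h := sum_le_of_dyadic F (fun p => Real.log p / p) (c := 2 * Real.log 4)
    (fun m hm => by
      have := Real.log_natCast_nonneg m
      positivity) hu ht hF ?_
  · refine h.trans ?_
    have : 2 * Real.log 4 * (t / Real.log 2 + 1) = 4 * t + 4 * Real.log 2 := by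
      rw [hl4]; field_simp; ring
    rw [this]
    linarith [Real.log_two_lt_d9]
  · -- On `[v, 2v)` the sum is at most `θ(2v) / v ≤ 2 log 4`.
    intro v hv
    have hv0 : 0 < v := lt_of_lt_of_le hu hv
    calc _ ≤ ∑ m ∈ F.filter (fun m : ℕ => v ≤ (m : ℝ) ∧ (m : ℝ) < 2 * v), Real.log m / v := by
          apply sum_le_sum
          intro m hm
          have hm' := (mem_filter.mp hm).2
          have := Real.log_natCast_nonneg m
          gcongr
          exact hm'.1
      _ = (∑ m ∈ F.filter (fun m : ℕ => v ≤ (m : ℝ) ∧ (m : ℝ) < 2 * v), Real.log m) / v := by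
          rw [sum_div]
      _ ≤ Chebyshev.theta (2 * v) / v := by
          gcongr
          rw [Chebyshev.theta_eq_sum_Icc]
          apply sum_le_sum_of_subset_of_nonneg
          · intro m hm
            obtain ⟨hmF, hm1, hm2⟩ := mem_filter.mp hm
            rw [mem_filter, mem_Icc]
            exact ⟨⟨Nat.zero_le _, Nat.le_floor hm2.le⟩, hP m hmF⟩
          · intro m _ _
            exact Real.log_natCast_nonneg m
      _ ≤ (Real.log 4 * (2 * v)) / v := by
          gcongr
          exact Chebyshev.theta_le_log4_mul_x (by positivity)
      _ = 2 * Real.log 4 := by field_simp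

theorem sum_inv_primes_le (F : Finset ℕ) (hP : ∀ p ∈ F, p.Prime) {u t l : ℝ} (hu : 0 < u)
    (ht : 0 ≤ t) (hl : 0 < l) (hF : ∀ m ∈ F, u ≤ m ∧ (m : ℝ) ≤ u * Real.exp t)
    (hF' : ∀ m ∈ F, l ≤ Real.log m) :
    ∑ p ∈ F, 1 / (p : ℝ) ≤ 4 * (t + 1) / l := by
  rw [le_div_iff₀ hl, sum_mul]
  refine le_trans (sum_le_sum fun p hp => ?_) (sum_log_div_le F hP hu ht hF)
  rw [div_mul_eq_mul_div, one_mul]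
  gcongr
  exact hF' p hp

theorem sum_inv_le_of_mem_Icc (F : Finset ℕ) {u t : ℝ} (hu : 1 ≤ u) (ht : 0 ≤ t)
    (hF : ∀ m ∈ F, u ≤ m ∧ (m : ℝ) ≤ u * Real.exp t) :
    ∑ m ∈ F, 1 / (m : ℝ) ≤ 3 * (t + 1) := by
  have h := sum_le_of_dyadic F (fun m => 1 / (m : ℝ)) (c := 2)
    (fun m hm => by positivity) (by linarith) ht hF ?_
  · refine h.trans ?_
    have : t / Real.log 2 ≤ 3 / 2 * t := by
      rw [div_le_iff₀ (Real.log_pos (by norm_num))]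
      nlinarith [Real.log_two_gt_d9]
    linarith
  · intro v hv
    have hv1 : 1 ≤ v := hu.trans hv
    have hcard : ((F.filter (fun m : ℕ => v ≤ (m : ℝ) ∧ (m : ℝ) < 2 * v)).card : ℝ) ≤ 2 * v := by
      have hsub : F.filter (fun m : ℕ => v ≤ (m : ℝ) ∧ (m : ℝ) < 2 * v) ⊆ Ico ⌈v⌉₊ ⌈2 * v⌉₊ := by
        intro m hm
        obtain ⟨-, h1, h2⟩ := mem_filter.mp hm
        rw [mem_Ico]
        exact ⟨Nat.ceil_le.mpr h1, Nat.lt_ceil.mpr h2⟩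
      have h1 := card_le_card hsub
      rw [Nat.card_Ico] at h1
      have h2 : ⌈2 * v⌉₊ - ⌈v⌉₊ ≤ ⌊2 * v⌋₊ := by
        have a : ⌈2 * v⌉₊ ≤ ⌊2 * v⌋₊ + 1 := Nat.ceil_le_floor_add_one _
        have b : 1 ≤ ⌈v⌉₊ := Nat.one_le_ceil_iff.mpr (by linarith)
        omega
      calc _ ≤ ((⌊2 * v⌋₊ : ℕ) : ℝ) := by exact_mod_cast h1.trans h2
        _ ≤ 2 * v := Nat.floor_le (by linarith)
    calc _ ≤ ∑ m ∈ F.filter (fun m : ℕ => v ≤ (m : ℝ) ∧ (m : ℝ) < 2 * v), 1 / v := by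
          apply sum_le_sum
          intro m hm
          have hm' := (mem_filter.mp hm).2
          gcongr
          exact hm'.1
      _ ≤ 2 := by
          rw [sum_const, nsmul_eq_mul, mul_one_div, div_le_iff₀ (by linarith)]
          exact hcard

/-- Reciprocal sums factor along a choice of divisors `φ m ∣ m`: the sum over `m` is at most the sum
over the divisors `d` that occur, times a bound `B` for the sum over the cofactors `m / d` for
fixed `d`. -/
theorem sum_inv_le_of_fiber (F : Finset ℕ) (φ : ℕ → ℕ) (hφ : ∀ m ∈ F, φ m ∣ m)
    (B : ℝ)
    (hB : ∀ d ∈ F.image φ,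
      ∑ c ∈ (F.filter (fun m => φ m = d)).image (fun m => m / d), 1 / (c : ℝ) ≤ B) :
    ∑ m ∈ F, 1 / (m : ℝ) ≤ B * ∑ d ∈ F.image φ, 1 / (d : ℝ) := by
  rw [← sum_fiberwise_of_maps_to (fun m hm => mem_image_of_mem φ hm), mul_sum]
  apply sum_le_sum
  intro d hd
  refine le_trans (le_of_eq ?_) (mul_le_mul_of_nonneg_right (hB d hd) (by positivity))
  have hdv : ∀ m ∈ F.filter (fun m => φ m = d), d ∣ m := fun m hm => by
    obtain ⟨h1, h2⟩ := mem_filter.mp hm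
    exact h2 ▸ hφ m h1
  rw [sum_image, sum_mul]
  · apply sum_congr rfl
    intro m hm
    obtain ⟨c, rfl⟩ := hdv m hm
    rcases Nat.eq_zero_or_pos d with rfl | h
    · simp
    · rw [Nat.mul_div_cancel_left c h]
      push_cast
      rw [one_div_mul_one_div, mul_comm]
  · intro m hm m' hm' h
    simp only at h
    rw [← Nat.mul_div_cancel' (hdv m hm), ← Nat.mul_div_cancel' (hdv m' hm'), h]

/-! ### Mertens-type bounds -/

theorem sum_Icc_rpow_neg_le (n : ℕ) {σ : ℝ} (hσ : 1 < σ) :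
    ∑ m ∈ Icc 1 n, (m : ℝ) ^ (-σ) ≤ 1 + 1 / (σ - 1) := by
  suffices h : ∀ n : ℕ, ∑ m ∈ Icc 1 (n + 1), (m : ℝ) ^ (-σ) ≤
      1 + 1 / (σ - 1) * (1 - ((n : ℝ) + 1) ^ (1 - σ)) by
    have hs : 0 < σ - 1 := by linarith
    rcases n with _ | n
    · simp; positivity
    · refine (h n).trans ?_
      have : 0 ≤ ((n : ℝ) + 1) ^ (1 - σ) := by positivity
      have : 1 / (σ - 1) * (1 - ((n : ℝ) + 1) ^ (1 - σ)) ≤ 1 / (σ - 1) * 1 := by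
        gcongr; linarith
      linarith
  intro n
  induction n with
  | zero => simp
  | succ n ih =>
    rw [sum_Icc_succ_top (by omega)]
    have hs : 0 < σ - 1 := by linarith
    set a : ℝ := (n : ℝ) + 1 with ha
    have ha0 : 0 < a := by positivity
    have h1 : a ^ (1 - σ) = (a + 1) ^ (1 - σ) * ((a + 1) / a) ^ (σ - 1) := by
      rw [Real.div_rpow (by positivity) (by positivity), mul_div_assoc',
        ← Real.rpow_add (by positivity)]
      rw [show 1 - σ + (σ - 1) = 0 by ring, Real.rpow_zero, one_div,
        ← Real.rpow_neg (by positivity), neg_sub]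
    have h2 : 1 + (σ - 1) * (1 / (a + 1)) ≤ ((a + 1) / a) ^ (σ - 1) := by
      have h3 := Real.one_sub_inv_le_log_of_pos (x := (a + 1) / a) (by positivity)
      have h4 : 1 - ((a + 1) / a)⁻¹ = 1 / (a + 1) := by field_simp; ring
      rw [h4] at h3
      rw [Real.rpow_def_of_pos (by positivity)]
      have := Real.add_one_le_exp (Real.log ((a + 1) / a) * (σ - 1))
      nlinarith [mul_le_mul_of_nonneg_left h3 hs.le]
    have h5 : (a + 1) ^ (-σ) = (a + 1) ^ (1 - σ) * (1 / (a + 1)) := by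
      rw [show -σ = (1 - σ) - 1 by ring, Real.rpow_sub_one (by positivity)]; ring
    have h6 : (0 : ℝ) < (a + 1) ^ (1 - σ) := by positivity
    have h7 := mul_le_mul_of_nonneg_left h2 h6.le
    rw [← h1, mul_add, mul_one] at h7
    push_cast
    rw [← ha, show (n : ℝ) + 1 + 1 = a + 1 by rw [ha], h5]
    have h8 : (a + 1) ^ (1 - σ) * (1 / (a + 1)) ≤
        1 / (σ - 1) * (a ^ (1 - σ) - (a + 1) ^ (1 - σ)) := by
      rw [one_div_mul_eq_div, le_div_iff₀ hs]; linarith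
    linarith

/-- Every finite part of the Euler product of `ζ(σ)` is at most `1 + 1 / (σ - 1)`. -/
theorem prod_inv_one_sub_rpow_le (s : Finset ℕ) {σ : ℝ} (hσ : 1 < σ) :
    ∏ p ∈ s with p.Prime, (1 - (p : ℝ) ^ (-σ))⁻¹ ≤ 1 + 1 / (σ - 1) := by
  refine hasSum_le_of_sum_le (hasSum_rpow_factoredNumbers s (by linarith)) fun F => ?_
  have hinj : Set.InjOn (Subtype.val : Nat.factoredNumbers s → ℕ) F :=
    Subtype.val_injective.injOn
  refine le_trans ?_ (sum_Icc_rpow_neg_le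
    ((F.image (Subtype.val : Nat.factoredNumbers s → ℕ)).sup id) hσ)
  rw [← sum_image (f := fun m : ℕ => (m : ℝ) ^ (-σ)) hinj]
  refine sum_le_sum_of_subset_of_nonneg (fun m hm => mem_Icc.mpr ⟨?_, le_sup (f := id) hm⟩)
    fun _ _ _ => by positivity
  obtain ⟨⟨m', h⟩, -, rfl⟩ := mem_image.mp hm
  exact Nat.pos_of_ne_zero (Nat.ne_zero_of_mem_factoredNumbers h)

/-- Mertens' upper bound `∏_{p ≤ n} (1 - 1/p)⁻¹ ≪ log n`. With `σ = 1 + 1 / log n`, replacing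
`1/p` by `p^(-σ)` costs a factor `exp (O(log p / (p log n)))` for each `p`, in total a bounded
factor, and the resulting product is at most `ζ(σ) ≤ 1 + 1 / (σ - 1)`. -/
theorem eulerProd_range_le {n : ℕ} (hn : 2 ≤ n) :
    eulerProd (range (n + 1)) ≤ Real.exp 12 * (1 + Real.log n) := by
  have hn' : (2 : ℝ) ≤ n := by exact_mod_cast hn
  have hl : 0 < Real.log n := Real.log_pos (by linarith)
  set σ : ℝ := 1 + 1 / Real.log n with hσ
  have hσ1 : 1 < σ := by rw [hσ]; linarith [one_div_pos.mpr hl]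
  set P := (range (n + 1)).filter Nat.Prime with hP
  have hP2 : ∀ p ∈ P, (2 : ℝ) ≤ p := fun p hp => by exact_mod_cast (mem_filter.mp hp).2.two_le
  have hfac : ∀ p ∈ P, (1 - (p : ℝ)⁻¹)⁻¹ ≤
      Real.exp (2 * (1 / Real.log n) * (Real.log p / p)) * (1 - (p : ℝ) ^ (-σ))⁻¹ := by
    intro p hp
    have hp2 := hP2 p hp
    have hp0 : (0 : ℝ) < p := by linarith
    have hinv : (p : ℝ)⁻¹ ≤ 1 / 2 := by rw [← one_div]; gcongr
    have hinv0 : 0 < (p : ℝ)⁻¹ := by positivity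
    have e1 : (p : ℝ) ^ (-σ) = (p : ℝ)⁻¹ * Real.exp (-(Real.log p / Real.log n)) := by
      rw [hσ, neg_add, Real.rpow_add hp0, Real.rpow_neg_one, Real.rpow_def_of_pos hp0]
      congr 2; ring
    have e2 : 1 - Real.log p / Real.log n ≤ Real.exp (-(Real.log p / Real.log n)) := by
      linarith [Real.add_one_le_exp (-(Real.log p / Real.log n))]
    have e3 : Real.exp (-(Real.log p / Real.log n)) ≤ 1 := by
      apply Real.exp_le_one_iff.mpr
      have : 0 ≤ Real.log p := Real.log_natCast_nonneg p
      have : 0 ≤ Real.log p / Real.log n := by positivity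
      linarith
    set w := Real.log p / Real.log n with hw
    set E := Real.exp (-w) with hE
    have e4 : 0 < 1 - (p : ℝ) ^ (-σ) := by rw [e1]; nlinarith
    rw [← div_eq_mul_inv, le_div_iff₀ e4, inv_mul_le_iff₀ (by linarith), e1]
    have e5 : 1 + 2 * (p : ℝ)⁻¹ * w ≤ Real.exp (2 * (1 / Real.log n) * (Real.log p / p)) := by
      have := Real.add_one_le_exp (2 * (1 / Real.log n) * (Real.log p / p))
      have e : 2 * (1 / Real.log n) * (Real.log p / p) = 2 * (p : ℝ)⁻¹ * w := by
        rw [hw]; ring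
      rw [e] at this ⊢; linarith
    have hw0 : 0 ≤ w := by
      have : 0 ≤ Real.log p := Real.log_natCast_nonneg p
      positivity
    set r := (p : ℝ)⁻¹ with hr
    calc 1 - r * E ≤ (1 - r) * (1 + 2 * r * w) := by
          nlinarith [mul_nonneg hinv0.le hw0,
            mul_nonneg (mul_nonneg hinv0.le hw0) (by linarith : 0 ≤ 1 / 2 - r),
            mul_le_mul_of_nonneg_left e2 hinv0.le]
      _ ≤ _ := by gcongr; linarith
  calc eulerProd (range (n + 1)) = ∏ p ∈ P, (1 - (p : ℝ)⁻¹)⁻¹ := rfl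
    _ ≤ ∏ p ∈ P, (Real.exp (2 * (1 / Real.log n) * (Real.log p / p)) * (1 - (p : ℝ) ^ (-σ))⁻¹) := by
        apply prod_le_prod _ hfac
        intro p hp
        linarith [one_le_inv_one_sub_inv (mem_filter.mp hp).2]
    _ = Real.exp (2 * (1 / Real.log n) * ∑ p ∈ P, Real.log p / p) *
          ∏ p ∈ P, (1 - (p : ℝ) ^ (-σ))⁻¹ := by
        rw [prod_mul_distrib, ← Real.exp_sum, mul_sum]
    _ ≤ Real.exp 12 * (1 + Real.log n) := by
        have hσ2 : 1 / (σ - 1) = Real.log n := by rw [hσ]; simp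
        gcongr
        · exact prod_nonneg fun p hp => by
            have := one_le_inv_one_sub_inv (mem_filter.mp hp).2
            have h1 : (p : ℝ) ^ (-σ) ≤ 1 :=
              Real.rpow_le_one_of_one_le_of_nonpos (by linarith [hP2 p hp]) (by linarith)
            exact inv_nonneg.mpr (by linarith)
        · have hl2 : Real.log 2 ≤ Real.log n := Real.log_le_log (by norm_num) hn'
          have h := sum_log_div_le P (fun p hp => (mem_filter.mp hp).2) (u := 2)
            (t := Real.log (n / 2)) (by norm_num) (Real.log_nonneg (by linarith)) fun p hp => by
              refine ⟨hP2 p hp, ?_⟩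
              rw [Real.exp_log (by linarith), mul_div_cancel₀ _ (by norm_num)]
              have := mem_range.mp (mem_filter.mp hp).1
              exact_mod_cast Nat.lt_succ_iff.mp this
          rw [Real.log_div (by linarith) (by norm_num)] at h
          calc _ ≤ 2 * (1 / Real.log n) * (4 * (Real.log n - Real.log 2 + 1)) := by gcongr
            _ ≤ 12 := by
              rw [mul_one_div, div_mul_eq_mul_div, div_le_iff₀ hl]
              linarith [Real.log_two_gt_d9]
        · rw [← hσ2]; exact prod_inv_one_sub_rpow_le _ hσ1

theorem log_le_eulerProd_range (n : ℕ) : Real.log (n + 1) ≤ eulerProd (range (n + 1)) := by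
  have h := sum_inv_le_eulerProd (range (n + 1)) (Icc 1 n) (fun m hm => by
    obtain ⟨h1, h2⟩ := mem_Icc.mp hm
    rw [Nat.mem_factoredNumbers_iff_primeFactors_subset]
    refine ⟨by omega, fun p hp => mem_range.mpr ?_⟩
    have := Nat.le_of_mem_primeFactors hp
    omega)
  refine le_trans ?_ h
  have := log_add_one_le_harmonic n
  rw [harmonic_eq_sum_Icc] at this
  push_cast at this
  simpa using this

theorem eulerProd_Ioc_le {a n : ℕ} (hn : 2 ≤ n) (ha : a ≤ n) (ha0 : 1 ≤ a) :
    eulerProd (Ioc a n) ≤ Real.exp 12 * (1 + Real.log n) / Real.log (a + 1) := by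
  have ha' : (1 : ℝ) ≤ a := by exact_mod_cast ha0
  rw [le_div_iff₀ (Real.log_pos (by linarith))]
  have h := eulerProd_union_mul_inter (Ioc a n) (range (a + 1))
  have hdis : Ioc a n ∩ range (a + 1) = ∅ := by
    ext m; simp only [mem_inter, mem_Ioc, mem_range, notMem_empty, iff_false]; omega
  have hun : Ioc a n ∪ range (a + 1) = range (n + 1) := by
    ext m; simp only [mem_union, mem_Ioc, mem_range]; omega
  -- The product over `(a, n]` is the quotient of the products up to `n` and up to `a`.
  rw [hdis, hun] at h
  have h1 : eulerProd ∅ = 1 := by simp [eulerProd]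
  rw [h1, mul_one] at h
  calc _ ≤ eulerProd (Ioc a n) * eulerProd (range (a + 1)) := by
        gcongr
        · linarith [one_le_eulerProd (Ioc a n)]
        · exact log_le_eulerProd_range a
    _ = _ := h.symm
    _ ≤ _ := eulerProd_range_le hn

/-- `∏_{p ∣ d} (1 - 1/p)⁻¹ = d / φ(d)` is at most of order `log log d`. -/
theorem eulerProd_primeFactors_le {d : ℕ} {Y : ℝ} (hd : d ≠ 0) (hdY : Real.log d ≤ Y) (hY : 2 ≤ Y) :
    eulerProd d.primeFactors ≤ Real.exp 16 * (1 + Real.log Y) := by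
  set n := ⌊Y⌋₊ with hn
  have hn2 : 2 ≤ n := Nat.le_floor (by exact_mod_cast hY)
  have hsub : d.primeFactors ⊆ range (n + 1) ∪ d.primeFactors.filter (fun p => n < p) := by
    intro p hp
    rw [mem_union, mem_range, mem_filter]
    by_cases h : n < p
    · exact Or.inr ⟨hp, h⟩
    · left; omega
  -- There are at most `log d / log 2` primes dividing `d`; those above `Y` contribute `O(1)`.
  have hbig : eulerProd (d.primeFactors.filter (fun p => n < p)) ≤ Real.exp 4 := by
    set B := d.primeFactors.filter (fun p => n < p) with hB
    have hYB : ∀ p ∈ B, Y < p := fun p hp =>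
      (Nat.lt_floor_add_one Y).trans_le (by exact_mod_cast (mem_filter.mp hp).2)
    have hcard : (B.card : ℝ) * Real.log 2 ≤ Y := by
      refine le_trans ?_ hdY
      rw [← Real.log_pow]
      apply Real.log_le_log (by positivity)
      have h1 : 2 ^ B.card ≤ ∏ p ∈ B, p := by
        apply pow_card_le_prod
        exact fun p hp => (Nat.prime_of_mem_primeFactors (mem_filter.mp hp).1).two_le
      have h2 : ∏ p ∈ B, p ∣ d :=
        (prod_dvd_prod_of_subset _ _ _ (filter_subset _ _)).trans (Nat.prod_primeFactors_dvd d)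
      exact_mod_cast h1.trans (Nat.le_of_dvd (Nat.pos_of_ne_zero hd) h2)
    calc eulerProd B ≤ ∏ p ∈ B.filter Nat.Prime, Real.exp (2 / Y) := by
          apply prod_le_prod
          · intro p hp
            linarith [one_le_inv_one_sub_inv (mem_filter.mp hp).2]
          · intro p hp
            have hp1 := hYB p (mem_filter.mp hp).1
            have hp2 : (p : ℝ)⁻¹ ≤ Y⁻¹ := by gcongr
            have hp3 : Y⁻¹ ≤ 1 / 2 := by rw [← one_div]; gcongr
            refine le_trans ?_ (Real.add_one_le_exp _)
            rw [inv_le_iff_one_le_mul₀ (by linarith), div_eq_mul_inv]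
            have hp4 : 0 < (p : ℝ)⁻¹ := inv_pos.mpr (by linarith)
            nlinarith
      _ = Real.exp ((B.filter Nat.Prime).card * (2 / Y)) := by
          rw [prod_const, ← Real.exp_nat_mul]
      _ ≤ Real.exp 4 := by
          have h3 : ((B.filter Nat.Prime).card : ℝ) ≤ B.card := by
            exact_mod_cast card_filter_le _ _
          gcongr
          rw [mul_div_assoc', div_le_iff₀ (by linarith)]
          nlinarith [Real.log_two_gt_d9]
  calc _ ≤ _ := eulerProd_mono hsub
    _ ≤ _ := eulerProd_union_le _ _
    _ ≤ (Real.exp 12 * (1 + Real.log n)) * Real.exp 4 := by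
        exact mul_le_mul (eulerProd_range_le hn2) hbig
          (by linarith [one_le_eulerProd (d.primeFactors.filter (fun p => n < p))])
          (by have := Real.log_natCast_nonneg n; positivity)
    _ ≤ (Real.exp 12 * (1 + Real.log Y)) * Real.exp 4 := by
        have : (2 : ℝ) ≤ n := by exact_mod_cast hn2
        gcongr
        exact Nat.floor_le (by linarith)
    _ = _ := by
        rw [show (16 : ℝ) = 12 + 4 by norm_num, Real.exp_add]; ring

/-! ### Smooth and rough parts, and numbers with few prime factors -/

/-- Every `m ≠ 0` is the product of a number all of whose prime factors are at most `n` and a number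
all of whose prime factors exceed `n`. -/
theorem exists_smooth_mul_rough (n : ℕ) {m : ℕ} (hm : m ≠ 0) :
    ∃ a b : ℕ, m = a * b ∧ (∀ p, p.Prime → p ∣ a → p ≤ n) ∧ (∀ p, p.Prime → p ∣ b → n < p) := by
  induction m using induction_on_primes with
  | zero => exact absurd rfl hm
  | one => exact ⟨1, 1, rfl, fun p hp h => absurd (Nat.dvd_one.mp h) hp.ne_one,
      fun p hp h => absurd (Nat.dvd_one.mp h) hp.ne_one⟩
  | prime_mul q m hq ih =>
    obtain ⟨a, b, rfl, ha, hb⟩ := ih (right_ne_zero_of_mul hm)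
    by_cases h : q ≤ n
    · refine ⟨q * a, b, by ring, fun p hp hd => ?_, hb⟩
      rcases (hp.dvd_mul).mp hd with h1 | h1
      · rwa [(Nat.prime_dvd_prime_iff_eq hp hq).mp h1]
      · exact ha p hp h1
    · refine ⟨a, q * b, by ring, ha, fun p hp hd => ?_⟩
      rcases (hp.dvd_mul).mp hd with h1 | h1
      · rw [(Nat.prime_dvd_prime_iff_eq hp hq).mp h1]; omega
      · exact hb p hp h1

/-- The largest prime factor of `m`, with value `1` at `m = 1` (and at `m = 0`). -/
def maxPrimeFac (m : ℕ) : ℕ := (insert 1 m.primeFactors).sup id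

theorem maxPrimeFac_mem (m : ℕ) : maxPrimeFac m ∈ insert 1 m.primeFactors := by
  obtain ⟨p, hp, h⟩ := exists_mem_eq_sup (insert 1 m.primeFactors) (insert_nonempty _ _) id
  unfold maxPrimeFac
  rw [h]; exact hp

theorem maxPrimeFac_dvd (m : ℕ) : maxPrimeFac m ∣ m := by
  rcases mem_insert.mp (maxPrimeFac_mem m) with h | h
  · rw [h]; exact one_dvd m
  · exact Nat.dvd_of_mem_primeFactors h

theorem maxPrimeFac_pos (m : ℕ) : 0 < maxPrimeFac m := by
  rcases mem_insert.mp (maxPrimeFac_mem m) with h | h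
  · omega
  · exact (Nat.prime_of_mem_primeFactors h).pos

theorem le_maxPrimeFac {m p : ℕ} (hm : m ≠ 0) (hp : p.Prime) (h : p ∣ m) : p ≤ maxPrimeFac m :=
  le_sup (f := id) (mem_insert_of_mem (Nat.mem_primeFactors.mpr ⟨hp, h, hm⟩))

theorem prime_maxPrimeFac {m : ℕ} (hm : 1 < m) : (maxPrimeFac m).Prime := by
  rcases mem_insert.mp (maxPrimeFac_mem m) with h | h
  · have h1 := le_maxPrimeFac (by omega) (Nat.minFac_prime hm.ne') (Nat.minFac_dvd m)
    have h2 := (Nat.minFac_prime hm.ne').two_le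
    omega
  · exact Nat.prime_of_mem_primeFactors h

theorem le_pow_cardFactors {m B : ℕ} (hm : m ≠ 0) (h : ∀ p, p.Prime → p ∣ m → p ≤ B) :
    m ≤ B ^ ArithmeticFunction.cardFactors m := by
  rw [ArithmeticFunction.cardFactors_apply]
  conv_lhs => rw [← Nat.prod_primeFactorsList hm]
  apply List.prod_le_pow_card
  intro p hp
  exact h p (Nat.prime_of_mem_primeFactorsList hp) (Nat.dvd_of_mem_primeFactorsList hp)

theorem cardFactors_le_of_dvd {a m : ℕ} (hm : m ≠ 0) (h : a ∣ m) :
    ArithmeticFunction.cardFactors a ≤ ArithmeticFunction.cardFactors m := by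
  obtain ⟨b, rfl⟩ := h
  rw [ArithmeticFunction.cardFactors_mul (left_ne_zero_of_mul hm) (right_ne_zero_of_mul hm)]
  exact Nat.le_add_right _ _

theorem log_le_mul_log_of_cardFactors_le {m B : ℕ} {k : ℝ} (hm : m ≠ 0)
    (h : ∀ p, p.Prime → p ∣ m → p ≤ B)
    (hk : (ArithmeticFunction.cardFactors m : ℝ) ≤ k) : Real.log m ≤ k * Real.log B := by
  have h1 : (m : ℝ) ≤ (B : ℝ) ^ ArithmeticFunction.cardFactors m := by
    exact_mod_cast le_pow_cardFactors hm h
  have h2 := Real.log_le_log (by positivity) h1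
  rw [Real.log_pow] at h2
  exact h2.trans (mul_le_mul_of_nonneg_right hk (Real.log_natCast_nonneg B))

/-- The reciprocal sum over primes `p ∈ [u, u e^T]` with `w / 2 < log p ≤ w` is `O(min 1 (T / w))`:
both constraints confine `log p` to an interval, of length `w / 2` and `T` respectively. The value
`p = 1` is allowed, and for `w ≤ 1` the lower bound on `log p` is dropped; this is the class of the
numbers without a prime factor `p ≥ 3`. -/
theorem sum_inv_scale_le (F : Finset ℕ) (hF : ∀ p ∈ F, p = 1 ∨ p.Prime) {u T w : ℝ} (hu : 0 < u)
    (hT : 1 ≤ T) (hw : 0 < w) (hu' : ∀ p ∈ F, u ≤ p ∧ (p : ℝ) ≤ u * Real.exp T)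
    (hw' : ∀ p ∈ F, Real.log p ≤ w) (hw'' : w ≤ 1 ∨ ∀ p ∈ F, w / 2 < Real.log p) :
    ∑ p ∈ F, 1 / (p : ℝ) ≤ 16 * min 1 (T / w) := by
  by_cases h1 : w ≤ 1
  · have h2 : F ⊆ {1, 2} := by
      intro p hp
      have h3 := (hw' p hp).trans h1
      have hp0 : 0 < p := by
        rcases hF p hp with h | h
        · omega
        · exact h.pos
      rw [Real.log_le_iff_le_exp (by positivity)] at h3
      have h4 : (p : ℝ) < 3 := by linarith [Real.exp_one_lt_d9]
      have h5 : p < 3 := by exact_mod_cast h4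
      simp only [mem_insert, mem_singleton]; omega
    have h3 : 1 ≤ T / w := by rw [le_div_iff₀ hw]; linarith
    rw [min_eq_left h3]
    refine (sum_le_sum_of_subset_of_nonneg h2 fun _ _ _ => by positivity).trans ?_
    norm_num
  · push Not at h1
    have hw3 := hw''.resolve_left (by linarith)
    have hP : ∀ p ∈ F, p.Prime := by
      intro p hp
      refine (hF p hp).resolve_left ?_
      rintro rfl
      have := hw3 1 hp
      simp at this; linarith
    rw [mul_min_of_nonneg _ _ (by norm_num), le_min_iff]
    constructor
    · refine (sum_inv_primes_le F hP one_pos hw.le (half_pos hw) (fun p hp => ⟨?_, ?_⟩)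
        fun p hp => (hw3 p hp).le).trans ?_
      · exact_mod_cast (hP p hp).one_le
      · have hp0 : (0 : ℝ) < p := by exact_mod_cast (hP p hp).pos
        rw [one_mul, ← Real.log_le_iff_le_exp hp0]; exact hw' p hp
      · rw [div_le_iff₀ (by linarith)]; linarith
    · refine (sum_inv_primes_le F hP hu (by linarith) (half_pos hw) hu'
        fun p hp => (hw3 p hp).le).trans ?_
      rw [div_le_iff₀ (by linarith)]
      have : 16 * (T / w) * (w / 2) = 8 * T := by field_simp; ring
      linarith

/-- A bound for the reciprocal sum over integers `d ∈ [X e^(-k w), X e^T]` with at most `k` prime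
factors, all larger than `n`. Write `d = p e` with `p` the largest prime factor. As `d ≤ p ^ k`, we
have `log p ≥ log X / (2k)`, and for given `e` the prime `p` lies in a multiplicative interval of
logarithmic length `T + k w`; the sum over the rough numbers `e` is `O(log X / v)` by Mertens. -/
theorem sum_inv_rough_le (D : Finset ℕ) (n : ℕ) (hn : 1 ≤ n) {X T w k v : ℝ} (hX : 1 ≤ Real.log X)
    (hX0 : 0 < X) (hT : 1 ≤ T) (hTX : T ≤ Real.log X) (hk : 1 ≤ k) (hw : 0 < w) (hv : 0 < v)
    (hvn : v ≤ Real.log (n + 1)) (hnX : (n : ℝ) ≤ X)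
    (hrough : ∀ d ∈ D, ∀ p, p.Prime → p ∣ d → n < p)
    (hD0 : ∀ d ∈ D, Real.log X / 2 ≤ Real.log d)
    (hD1 : ∀ d ∈ D, X * Real.exp (-(k * w)) ≤ d) (hD2 : ∀ d ∈ D, (d : ℝ) ≤ X * Real.exp T)
    (hΩ : ∀ d ∈ D, (ArithmeticFunction.cardFactors d : ℝ) ≤ k) :
    ∑ d ∈ D, 1 / (d : ℝ) ≤ 24 * Real.exp 12 * k * (T + k * w + 1) / v := by
  have hd1 : ∀ d ∈ D, 1 < d := by
    intro d hd
    by_contra h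
    have : (d : ℝ) ≤ 1 := by exact_mod_cast not_lt.mp h
    have := Real.log_nonpos (by positivity) this
    linarith [hD0 d hd]
  have h1 := sum_inv_le_of_fiber D (fun d => d / maxPrimeFac d)
    (fun d _ => Nat.div_dvd_of_dvd (maxPrimeFac_dvd d))
    (4 * (T + k * w + 1) / (Real.log X / (2 * k))) ?_
  · refine h1.trans ?_
    have h2 : ∑ d ∈ D.image (fun d => d / maxPrimeFac d), 1 / (d : ℝ) ≤
        Real.exp 12 * (3 * Real.log X) / v := by
      have hXn : 2 ≤ ⌊X * Real.exp T⌋₊ := by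
        apply Nat.le_floor
        have : Real.exp 1 ≤ X := by rwa [← Real.le_log_iff_exp_le hX0]
        have h3 := Real.exp_one_gt_d9
        have h4 : 1 ≤ Real.exp T := Real.one_le_exp (by linarith)
        push_cast; nlinarith
      have hle : (⌊X * Real.exp T⌋₊ : ℝ) ≤ X * Real.exp T := Nat.floor_le (by positivity)
      refine (sum_inv_le_eulerProd (Ioc n ⌊X * Real.exp T⌋₊) _ ?_).trans
        ((eulerProd_Ioc_le hXn ?_ hn).trans ?_)
      · intro e he
        obtain ⟨d, hd, rfl⟩ := mem_image.mp he
        have hdd := Nat.div_dvd_of_dvd (maxPrimeFac_dvd d)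
        have hd0 := hd1 d hd
        rw [Nat.mem_factoredNumbers_iff_primeFactors_subset]
        refine ⟨fun h => ?_, fun p hp => ?_⟩
        · rw [h, zero_dvd_iff] at hdd; omega
        · have hpd := (Nat.dvd_of_mem_primeFactors hp).trans hdd
          rw [mem_Ioc]
          refine ⟨hrough d hd p (Nat.prime_of_mem_primeFactors hp) hpd, Nat.le_floor ?_⟩
          refine le_trans ?_ (hD2 d hd)
          exact_mod_cast Nat.le_of_dvd (by omega) hpd
      · apply Nat.le_floor
        have h4 : 1 ≤ Real.exp T := Real.one_le_exp (by linarith)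
        nlinarith
      · have : Real.log ⌊X * Real.exp T⌋₊ ≤ Real.log X + T := by
          rw [← Real.log_exp T, ← Real.log_mul hX0.ne' (Real.exp_pos _).ne']
          rw [Real.log_exp]
          exact Real.log_le_log (by positivity) hle
        gcongr
        linarith
    have h3 : 0 ≤ 4 * (T + k * w + 1) / (Real.log X / (2 * k)) := by positivity
    refine (mul_le_mul_of_nonneg_left h2 h3).trans (le_of_eq ?_)
    have : Real.log X ≠ 0 := by linarith
    field_simp
    ring
  · intro e he
    have hP : ∀ c ∈ (D.filter (fun m => m / maxPrimeFac m = e)).image (fun m => m / e),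
        ∃ d ∈ D, d = e * c ∧ c = maxPrimeFac d := by
      intro c hc
      obtain ⟨d, hd, rfl⟩ := mem_image.mp hc
      obtain ⟨hdD, rfl⟩ := mem_filter.mp hd
      have h2 := Nat.div_div_self (maxPrimeFac_dvd d) (by have := hd1 d hdD; omega)
      refine ⟨d, hdD, ?_, h2⟩
      rw [h2, Nat.div_mul_cancel (maxPrimeFac_dvd d)]
    have he0 : (0 : ℝ) < e := by
      obtain ⟨d, hd, rfl⟩ := mem_image.mp he
      have := Nat.div_pos (Nat.le_of_dvd (by have := hd1 d hd; omega) (maxPrimeFac_dvd d))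
        (maxPrimeFac_pos d)
      exact_mod_cast this
    refine sum_inv_primes_le (u := X * Real.exp (-(k * w)) / e) _ ?_ ?_ ?_ ?_ ?_ ?_
    · intro c hc
      obtain ⟨d, hd, -, rfl⟩ := hP c hc
      exact prime_maxPrimeFac (hd1 d hd)
    · positivity
    · positivity
    · positivity
    · intro c hc
      obtain ⟨d, hd, hdc, -⟩ := hP c hc
      have hdc' : (d : ℝ) = e * c := by exact_mod_cast hdc
      have h2 := hD1 d hd
      have h3 := hD2 d hd
      rw [hdc'] at h2 h3
      constructor
      · rw [div_le_iff₀ he0]; linarith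
      · rw [div_mul_eq_mul_div, le_div_iff₀ he0, mul_assoc, ← Real.exp_add]
        ring_nf at h3 ⊢; exact h3
    · intro c hc
      obtain ⟨d, hd, -, rfl⟩ := hP c hc
      have h2 := log_le_mul_log_of_cardFactors_le (by have := hd1 d hd; omega)
        (fun p hp h => le_maxPrimeFac (by have := hd1 d hd; omega) hp h)
        (hΩ d hd)
      rw [div_le_iff₀ (by positivity)]
      linarith [hD0 d hd]

/-! ### Divisors of nearby integers -/

/-- The contribution to `sum_inv_divisors_le` of those `m = a b`, with smooth part `a` and rough
part `b`, for which the largest prime factor `p` of `a` satisfies `w / 2 < log p ≤ w` (or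
`log p ≤ w ≤ 1`). For given `b` we have `a ∣ y b`, so the sum over `a / p` is at most the Euler
product `G` over the small primes dividing `y b`, and the sum over `p` is `O(min 1 (T / w))`. As
`a ≤ exp (k w)`, the sum over `b` is bounded by `sum_inv_rough_le`. -/
theorem sum_inv_class_le (F : Finset ℕ) (a b : ℕ → ℕ) (y : ℕ → ℤ) (n : ℕ) (hn : 1 ≤ n)
    {X T w k v G : ℝ} (hG0 : 0 ≤ G) (hX : 1 ≤ Real.log X)
    (hX0 : 0 < X) (hT : 1 ≤ T) (hTX : T ≤ Real.log X) (hk : 1 ≤ k) (hw : 0 < w) (hv : 0 < v)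
    (hvn : v ≤ Real.log (n + 1)) (hnX : (n : ℝ) ≤ X)
    (hab : ∀ m ∈ F, m = a m * b m)
    (ha : ∀ m ∈ F, ∀ p, p.Prime → p ∣ a m → p ≤ n)
    (hb : ∀ m ∈ F, ∀ p, p.Prime → p ∣ b m → n < p)
    (hFX : ∀ m ∈ F, X ≤ m ∧ (m : ℝ) ≤ X * Real.exp T)
    (hΩ : ∀ m ∈ F, (ArithmeticFunction.cardFactors m : ℝ) ≤ k)
    (hw1 : ∀ m ∈ F, Real.log (maxPrimeFac (a m)) ≤ w)
    (hw2 : w ≤ 1 ∨ ∀ m ∈ F, w / 2 < Real.log (maxPrimeFac (a m)))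
    (hbX : ∀ m ∈ F, Real.log X / 2 ≤ Real.log (b m))
    (hy : ∀ m ∈ F, (a m : ℤ) ∣ y (b m))
    (hG : ∀ m ∈ F, eulerProd ((range (n + 1)).filter (fun p => (p : ℤ) ∣ y (b m))) ≤ G) :
    ∑ m ∈ F, 1 / (m : ℝ) ≤ (16 * min 1 (T / w) * G) *
      (24 * Real.exp 12 * k * (T + k * w + 1) / v) := by
  have hm0 : ∀ m ∈ F, m ≠ 0 := by
    rintro m hm rfl
    have := (hFX 0 hm).1
    simp at this; linarith
  have ha0 : ∀ m ∈ F, a m ≠ 0 := fun m hm h => hm0 m hm (by rw [hab m hm, h, zero_mul])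
  have hb0 : ∀ m ∈ F, b m ≠ 0 := fun m hm h => hm0 m hm (by rw [hab m hm, h, mul_zero])
  have hcast : ∀ m ∈ F, (m : ℝ) = a m * b m := fun m hm => by exact_mod_cast hab m hm
  have hβ : 0 ≤ 16 * min 1 (T / w) := by positivity
  refine (sum_inv_le_of_fiber F b (fun m hm => ⟨a m, by rw [mul_comm]; exact hab m hm⟩)
    (16 * min 1 (T / w) * G) ?_).trans ?_
  · intro d hd
    set 𝒜 := (F.filter (fun m => b m = d)).image (fun m => m / d) with h𝒜
    have hA : ∀ c ∈ 𝒜, ∃ m ∈ F, b m = d ∧ a m = c := by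
      intro c hc
      obtain ⟨m, hm, rfl⟩ := mem_image.mp hc
      obtain ⟨hmF, rfl⟩ := mem_filter.mp hm
      refine ⟨m, hmF, rfl, ?_⟩
      exact (Nat.div_eq_of_eq_mul_left (Nat.pos_of_ne_zero (hb0 m hmF)) (hab m hmF)).symm
    have hc0 : ∀ c ∈ 𝒜, c ≠ 0 := by
      intro c hc
      obtain ⟨m, hm, -, rfl⟩ := hA c hc
      exact ha0 m hm
    have hd0 : (0 : ℝ) < d := by
      obtain ⟨m, hm, rfl⟩ := mem_image.mp hd
      exact_mod_cast Nat.pos_of_ne_zero (hb0 m hm)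
    refine (sum_inv_le_of_fiber 𝒜 (fun c => c / maxPrimeFac c)
      (fun c _ => Nat.div_dvd_of_dvd (maxPrimeFac_dvd c)) (16 * min 1 (T / w)) ?_).trans ?_
    · intro e he
      have hP : ∀ p ∈ (𝒜.filter (fun c => c / maxPrimeFac c = e)).image (fun c => c / e),
          ∃ m ∈ F, b m = d ∧ a m = e * p ∧ p = maxPrimeFac (a m) := by
        intro p hp
        obtain ⟨c, hc, rfl⟩ := mem_image.mp hp
        obtain ⟨hcA, rfl⟩ := mem_filter.mp hc
        obtain ⟨m, hm, hbm, rfl⟩ := hA c hcA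
        have h2 := Nat.div_div_self (maxPrimeFac_dvd (a m)) (ha0 m hm)
        refine ⟨m, hm, hbm, ?_, h2⟩
        rw [h2, Nat.div_mul_cancel (maxPrimeFac_dvd (a m))]
      have he0 : (0 : ℝ) < e := by
        obtain ⟨c, hc, rfl⟩ := mem_image.mp he
        have := Nat.div_pos (Nat.le_of_dvd (Nat.pos_of_ne_zero (hc0 c hc)) (maxPrimeFac_dvd c))
          (maxPrimeFac_pos c)
        exact_mod_cast this
      refine sum_inv_scale_le (u := X / (e * d)) _ ?_ (by positivity) hT hw ?_ ?_ ?_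
      · intro p hp
        obtain ⟨m, hm, -, -, rfl⟩ := hP p hp
        exact (mem_insert.mp (maxPrimeFac_mem _)).imp id Nat.prime_of_mem_primeFactors
      · intro p hp
        obtain ⟨m, hm, rfl, h2, -⟩ := hP p hp
        have h3 := hcast m hm
        rw [h2] at h3
        push_cast at h3
        have h4 := hFX m hm
        rw [h3] at h4
        rw [div_le_iff₀ (by positivity), div_mul_eq_mul_div, le_div_iff₀ (by positivity)]
        constructor
        · linarith [h4.1]
        · linarith [h4.2]
      · intro p hp
        obtain ⟨m, hm, -, -, rfl⟩ := hP p hp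
        exact hw1 m hm
      · refine hw2.imp id fun h p hp => ?_
        obtain ⟨m, hm, -, -, rfl⟩ := hP p hp
        exact h m hm
    · refine mul_le_mul_of_nonneg_left ?_ hβ
      obtain ⟨m₁, hm₁, hbm₁⟩ := mem_image.mp hd
      refine (sum_inv_le_eulerProd ((range (n + 1)).filter (fun p => (p : ℤ) ∣ y d)) _ ?_).trans
        (hbm₁ ▸ hG m₁ hm₁)
      intro e he
      obtain ⟨c, hc, rfl⟩ := mem_image.mp he
      have hdd := Nat.div_dvd_of_dvd (maxPrimeFac_dvd c)
      obtain ⟨m, hm, rfl, rfl⟩ := hA c hc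
      rw [Nat.mem_factoredNumbers_iff_primeFactors_subset]
      refine ⟨fun h => ?_, fun p hp => ?_⟩
      · rw [h, zero_dvd_iff] at hdd; exact ha0 m hm hdd
      · have hpd := (Nat.dvd_of_mem_primeFactors hp).trans hdd
        rw [mem_filter, mem_range, Nat.lt_succ_iff]
        exact ⟨ha m hm p (Nat.prime_of_mem_primeFactors hp) hpd,
          (Int.natCast_dvd_natCast.mpr hpd).trans (hy m hm)⟩
  · refine mul_le_mul_of_nonneg_left ?_ (by positivity)
    refine sum_inv_rough_le _ n hn hX hX0 hT hTX hk hw hv hvn hnX ?_ ?_ ?_ ?_ ?_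
    · intro d hd p hp hpd
      obtain ⟨m, hm, rfl⟩ := mem_image.mp hd
      exact hb m hm p hp hpd
    · intro d hd
      obtain ⟨m, hm, rfl⟩ := mem_image.mp hd
      exact hbX m hm
    · intro d hd
      obtain ⟨m, hm, rfl⟩ := mem_image.mp hd
      have hla : Real.log (a m) ≤ k * w :=
        (log_le_mul_log_of_cardFactors_le (ha0 m hm)
          (fun p hp h => le_maxPrimeFac (ha0 m hm) hp h)
          ((Nat.cast_le.mpr (cardFactors_le_of_dvd (hm0 m hm) ⟨b m, hab m hm⟩)).trans
            (hΩ m hm))).trans (mul_le_mul_of_nonneg_left (hw1 m hm) (by linarith))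
      have ha1 : (0 : ℝ) < a m := by exact_mod_cast Nat.pos_of_ne_zero (ha0 m hm)
      rw [Real.log_le_iff_le_exp ha1] at hla
      have h1 := (hFX m hm).1
      rw [hcast m hm] at h1
      rw [Real.exp_neg, ← div_eq_mul_inv, div_le_iff₀ (Real.exp_pos _)]
      have : (0 : ℝ) ≤ b m := by positivity
      nlinarith
    · intro d hd
      obtain ⟨m, hm, rfl⟩ := mem_image.mp hd
      refine le_trans ?_ (hFX m hm).2
      exact_mod_cast Nat.le_of_dvd (Nat.pos_of_ne_zero (hm0 m hm))
        ⟨a m, by rw [mul_comm]; exact hab m hm⟩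
    · intro d hd
      obtain ⟨m, hm, rfl⟩ := mem_image.mp hd
      exact (Nat.cast_le.mpr (cardFactors_le_of_dvd (hm0 m hm)
        ⟨a m, by rw [mul_comm]; exact hab m hm⟩)).trans (hΩ m hm)

/-- Let each `m ∈ F ⊆ [X, X e^T]` have at most `k` prime factors and divide `y m`, where `y m` is
already determined by any divisor of `m` that is at least `X e^(-V/2)`. If the primes
`p ≤ exp (V / (2k))` dividing `y m` have Euler product at most `G` for all `m ∈ F`, then the
reciprocal sum of `F` is `O(I k³ G T / V)`. The point is the saving of `V`, which comes from
the roughness of the cofactor of the smooth part of `m`; the factor `I + 1` counts the dyadic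
classes for the logarithm of the largest prime factor of the smooth part. -/
theorem sum_inv_divisors_le (F : Finset ℕ) (y : ℕ → ℤ) (I : ℕ)
    {X T V k G : ℝ} (hX0 : 0 < X) (hT : 1 ≤ T) (hTX : T ≤ Real.log X) (hk : 1 ≤ k) (hV : 0 < V)
    (hVX : V ≤ Real.log X) (hVI : V ≤ 2 ^ I) (hG0 : 0 ≤ G)
    (hFX : ∀ m ∈ F, X ≤ m ∧ (m : ℝ) ≤ X * Real.exp T)
    (hΩ : ∀ m ∈ F, (ArithmeticFunction.cardFactors m : ℝ) ≤ k)
    (hy : ∀ m ∈ F, (m : ℤ) ∣ y m)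
    (hyy : ∀ m ∈ F, ∀ m' ∈ F, ∀ d : ℕ, d ∣ m → d ∣ m' → X * Real.exp (-(V / 2)) ≤ d → y m = y m')
    (hG : ∀ m ∈ F, eulerProd ((range (⌊Real.exp (V / (2 * k))⌋₊ + 1)).filter
      (fun p => (p : ℤ) ∣ y m)) ≤ G) :
    ∑ m ∈ F, 1 / (m : ℝ) ≤ (I + 1) * (2304 * Real.exp 12 * k ^ 3 * G * T / V) := by
  set n := ⌊Real.exp (V / (2 * k))⌋₊ with hn
  have hn1 : 1 ≤ n := Nat.le_floor (by
    push_cast; exact Real.one_le_exp (by positivity))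
  have hne : (n : ℝ) ≤ Real.exp (V / (2 * k)) := Nat.floor_le (by positivity)
  have hlogn : Real.log n ≤ V / (2 * k) := by
    rw [Real.log_le_iff_le_exp (by positivity)]; exact hne
  have hm0 : ∀ m ∈ F, m ≠ 0 := by
    rintro m hm rfl
    have := (hFX 0 hm).1
    simp at this; linarith
  have hdec : ∀ m : ℕ, ∃ a b : ℕ, m ∈ F → m = a * b ∧ (∀ p, p.Prime → p ∣ a → p ≤ n) ∧
      (∀ p, p.Prime → p ∣ b → n < p) := by
    intro m
    by_cases hm : m ∈ F
    · obtain ⟨a, b, h⟩ := exists_smooth_mul_rough n (hm0 m hm)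
      exact ⟨a, b, fun _ => h⟩
    · exact ⟨0, 0, fun h => absurd h hm⟩
  choose a b hab using hdec
  have ha0 : ∀ m ∈ F, a m ≠ 0 := fun m hm h => hm0 m hm (by rw [(hab m hm).1, h, zero_mul])
  have hb0 : ∀ m ∈ F, b m ≠ 0 := fun m hm h => hm0 m hm (by rw [(hab m hm).1, h, mul_zero])
  -- The smooth part `a m` has at most `k` prime factors, each at most `exp (V / (2k))`.
  have hla : ∀ m ∈ F, Real.log (a m) ≤ V / 2 := by
    intro m hm
    refine (log_le_mul_log_of_cardFactors_le (ha0 m hm) (hab m hm).2.1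
      ((Nat.cast_le.mpr (cardFactors_le_of_dvd (hm0 m hm) ⟨b m, (hab m hm).1⟩)).trans
            (hΩ m hm))).trans ?_
    calc k * Real.log n ≤ k * (V / (2 * k)) := by gcongr
      _ = V / 2 := by field_simp
  have hbX : ∀ m ∈ F, X * Real.exp (-(V / 2)) ≤ b m := by
    intro m hm
    have ha1 : (0 : ℝ) < a m := by exact_mod_cast Nat.pos_of_ne_zero (ha0 m hm)
    have h0 := hla m hm
    rw [Real.log_le_iff_le_exp ha1] at h0
    have h1 := (hFX m hm).1
    have h2 : (m : ℝ) = a m * b m := by exact_mod_cast (hab m hm).1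
    rw [h2] at h1
    rw [Real.exp_neg, ← div_eq_mul_inv, div_le_iff₀ (Real.exp_pos _)]
    have : (0 : ℝ) ≤ b m := by positivity
    nlinarith
  -- Hence `y m` depends only on the rough part `b m`.
  have hy' : ∃ y' : ℕ → ℤ, ∀ m ∈ F, y' (b m) = y m := by
    classical
    refine ⟨fun d => if h : ∃ m ∈ F, b m = d then y h.choose else 0, fun m hm => ?_⟩
    have h : ∃ m' ∈ F, b m' = b m := ⟨m, hm, rfl⟩
    simp only [h, dif_pos]
    obtain ⟨h1, h2⟩ := h.choose_spec
    refine hyy _ h1 m hm (b m) ?_ ⟨a m, by rw [mul_comm]; exact (hab m hm).1⟩ (hbX m hm)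
    conv_lhs => rw [← h2]
    exact ⟨a _, by rw [mul_comm]; exact (hab _ h1).1⟩
  obtain ⟨y', hy'⟩ := hy'
  -- In class `i ≥ 1` the largest prime factor `p` of `a m` has `2 ^ (i - 1) < log p ≤ 2 ^ i`.
  set ι : ℕ → ℕ := fun m => Nat.clog 2 ⌈Real.log (maxPrimeFac (a m))⌉₊ with hι
  have hmaps : ∀ m ∈ F, ι m ∈ range (I + 1) := by
    intro m hm
    rw [mem_range, Nat.lt_succ_iff, hι]
    simp only
    rw [Nat.clog_le_iff_le_pow (by norm_num), Nat.ceil_le]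
    push_cast
    refine le_trans ?_ hVI
    have h1 : maxPrimeFac (a m) ≤ n := by
      rcases mem_insert.mp (maxPrimeFac_mem (a m)) with h | h
      · omega
      · exact (hab m hm).2.1 _ (Nat.prime_of_mem_primeFactors h) (Nat.dvd_of_mem_primeFactors h)
    have h2 : (0 : ℝ) < maxPrimeFac (a m) := by exact_mod_cast maxPrimeFac_pos _
    calc Real.log (maxPrimeFac (a m)) ≤ Real.log n := Real.log_le_log h2 (by exact_mod_cast h1)
      _ ≤ V / (2 * k) := hlogn
      _ ≤ V := div_le_self hV.le (by linarith)
  rw [← sum_fiberwise_of_maps_to hmaps]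
  have hclass : ∀ i ∈ range (I + 1), ∑ m ∈ F.filter (fun m => ι m = i), 1 / (m : ℝ) ≤
      2304 * Real.exp 12 * k ^ 3 * G * T / V := by
    intro i _
    have hsub : ∀ m ∈ F.filter (fun m => ι m = i), m ∈ F := fun m hm => (mem_filter.mp hm).1
    have h := sum_inv_class_le (F.filter (fun m => ι m = i)) a b y' n hn1 (X := X) (T := T)
      (w := 2 ^ i) (k := k) (v := V / (2 * k)) (G := G) hG0 (by linarith) hX0 hT hTX hk
      (by positivity)
      (by positivity) ?_ ?_ (fun m hm => (hab m (hsub m hm)).1)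
      (fun m hm => (hab m (hsub m hm)).2.1) (fun m hm => (hab m (hsub m hm)).2.2)
      (fun m hm => hFX m (hsub m hm)) (fun m hm => hΩ m (hsub m hm)) ?_ ?_ ?_ ?_ ?_
    · refine h.trans ?_
      set w : ℝ := 2 ^ i with hw
      have hw0 : 0 < w := by positivity
      have h1 : T + k * w + 1 ≤ 3 * k * max T w := by
        have := le_max_left T w
        have := le_max_right T w
        nlinarith
      have h2 : min 1 (T / w) * max T w ≤ T := by
        rcases le_total T w with h | h
        · rw [max_eq_right h]
          calc _ ≤ T / w * w := by gcongr; exact min_le_right _ _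
            _ = T := by field_simp
        · rw [max_eq_left h]
          exact mul_le_of_le_one_left (by linarith) (min_le_left _ _)
      calc _ ≤ 16 * min 1 (T / w) * G *
            (24 * Real.exp 12 * k * (3 * k * max T w) / (V / (2 * k))) := by
            gcongr
        _ = 2304 * Real.exp 12 * k ^ 3 * G * (min 1 (T / w) * max T w) / V := by
            field_simp; ring
        _ ≤ _ := by gcongr
    · rw [Real.le_log_iff_exp_le (by positivity)]
      exact (Nat.lt_floor_add_one _).le
    · refine hne.trans ?_
      rw [← Real.le_log_iff_exp_le hX0]
      exact (div_le_self hV.le (by linarith)).trans hVX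
    · intro m hm
      obtain ⟨hmF, hi⟩ := mem_filter.mp hm
      have h1 := Nat.le_pow_clog (b := 2) (by norm_num) ⌈Real.log (maxPrimeFac (a m))⌉₊
      rw [show Nat.clog 2 ⌈Real.log (maxPrimeFac (a m))⌉₊ = i from hi, Nat.ceil_le] at h1
      exact_mod_cast h1
    · rcases Nat.eq_zero_or_pos i with rfl | hi0
      · left; simp
      · right
        intro m hm
        obtain ⟨hmF, hi⟩ := mem_filter.mp hm
        have h1 : i - 1 < Nat.clog 2 ⌈Real.log (maxPrimeFac (a m))⌉₊ := by
          rw [show Nat.clog 2 ⌈Real.log (maxPrimeFac (a m))⌉₊ = i from hi]; omega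
        rw [Nat.lt_clog_iff_pow_lt (by norm_num), Nat.lt_ceil] at h1
        push_cast at h1
        refine lt_of_eq_of_lt ?_ h1
        obtain ⟨j, rfl⟩ : ∃ j, i = j + 1 := ⟨i - 1, by omega⟩
        simp [pow_succ]
    · intro m hm
      have h1 := Real.log_le_log (by positivity) (hbX m (hsub m hm))
      rw [Real.log_mul hX0.ne' (Real.exp_pos _).ne', Real.log_exp] at h1
      linarith
    · intro m hm
      rw [hy' m (hsub m hm)]
      exact (Int.natCast_dvd_natCast.mpr ⟨b m, (hab m (hsub m hm)).1⟩).trans (hy m (hsub m hm))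
    · intro m hm
      rw [hy' m (hsub m hm)]
      exact hG m (hsub m hm)
  calc _ ≤ ∑ i ∈ range (I + 1), 2304 * Real.exp 12 * k ^ 3 * G * T / V := sum_le_sum hclass
    _ = _ := by simp

/-! ### A common multiple near a given frequency -/

/-- `n` divides some integer at distance at most `K / 2` from `h`. -/
def DividesNear (K : ℝ) (h : ℤ) (n : ℕ) : Prop := ∃ x : ℤ, |(x : ℝ) - h| ≤ K / 2 ∧ (n : ℤ) ∣ x

/-- The part of the Euler product at the primes `p ≤ e ^ (V / (2 k))` dividing `x`. -/
noncomputable def smoothWeight (V k : ℝ) (x : ℤ) : ℝ :=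
  eulerProd ((range (⌊Real.exp (V / (2 * k))⌋₊ + 1)).filter (fun p => (p : ℤ) ∣ x))

open Classical in
/-- If the `n ∈ A_q` that divide an integer near `h` have a large reciprocal sum, then some multiple
`x` of `q` near `h` is divisible by so many primes up to `exp (V / (2k))` that its weight
exceeds `G`. Otherwise `sum_inv_divisors_le` applies to the quotients `n / q`: if `d` divides two of
them and `d ≥ (M / q) e^(-V/2)`, then the attached multiples of `q d > K` are at distance at most
`K`, hence equal. -/
theorem exists_multiple_smoothWeight (A : Finset ℕ) (I q : ℕ) (h : ℤ) {N M K T V k G c : ℝ}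
    (hM : 0 < M) (hq : 0 < q) (hA : ∀ n ∈ A, M ≤ (n : ℝ) ∧ (n : ℝ) ≤ N)
    (hΩ : ∀ n ∈ A, (ArithmeticFunction.cardFactors n : ℝ) ≤ k)
    (hNT : N = M * Real.exp T) (hT : 1 ≤ T) (hqT : q * Real.exp T ≤ M)
    (hk : 1 ≤ k) (hV : 0 < V) (hVI : V ≤ 2 ^ I) (hqK : (q : ℝ) ≤ K) (hK : K ≤ M * Real.exp (-V))
    (hG : 0 ≤ G) (hGc : (I + 1) * (2304 * Real.exp 12 * k ^ 3 * G * T / V) < c)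
    (hc : c ≤ q * ∑ n ∈ (multiplesIn A q).filter (DividesNear K h), 1 / (n : ℝ)) :
    ∃ x : ℤ, |(x : ℝ) - h| ≤ K / 2 ∧ (q : ℤ) ∣ x ∧ G < smoothWeight V k x := by
  by_contra! hcon
  have hq0 : (0 : ℝ) < q := by exact_mod_cast hq
  set B := (multiplesIn A q).filter (DividesNear K h) with hB
  have hBA : ∀ n ∈ B, n ∈ A ∧ q ∣ n ∧ DividesNear K h n := fun n hn => by
    obtain ⟨h1, h2⟩ := mem_filter.mp hn
    obtain ⟨h3, h4⟩ := mem_filter.mp h1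
    exact ⟨h3, h4, h2⟩
  set F := B.image (fun n => n / q) with hF
  have hF' : ∀ m ∈ F, q * m ∈ B := by
    intro m hm
    obtain ⟨n, hn, rfl⟩ := mem_image.mp hm
    rwa [Nat.mul_div_cancel' (hBA n hn).2.1]
  have hsum : q * ∑ n ∈ B, 1 / (n : ℝ) = ∑ m ∈ F, 1 / (m : ℝ) := by
    rw [hF, sum_image, mul_sum]
    · apply sum_congr rfl
      intro n hn
      obtain ⟨m, rfl⟩ := (hBA n hn).2.1
      rw [Nat.mul_div_cancel_left m hq]
      push_cast
      rcases eq_or_ne (m : ℝ) 0 with h | h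
      · simp [h]
      · field_simp
    · intro n hn n' hn' h
      simp only at h
      rw [← Nat.mul_div_cancel' (hBA n hn).2.1, ← Nat.mul_div_cancel' (hBA n' hn').2.1, h]
  have hy : ∀ m : ℕ, ∃ x : ℤ, m ∈ F → |(x : ℝ) - h| ≤ K / 2 ∧ ((q * m : ℕ) : ℤ) ∣ x := by
    intro m
    by_cases hm : m ∈ F
    · obtain ⟨x, hx⟩ := (hBA _ (hF' m hm)).2.2
      exact ⟨x, fun _ => hx⟩
    · exact ⟨0, fun h => absurd h hm⟩
  choose y hy using hy
  have hX : Real.exp V ≤ M / q := by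
    rw [le_div_iff₀ hq0]
    have := hqK.trans hK
    rw [Real.exp_neg, ← div_eq_mul_inv, le_div_iff₀ (Real.exp_pos _)] at this
    linarith
  have hX0 : 0 < M / q := by positivity
  have key := sum_inv_divisors_le F y I (X := M / q) (T := T) (V := V) (k := k) (G := G) hX0 hT
    (by rw [Real.le_log_iff_exp_le hX0, le_div_iff₀ hq0]; linarith) hk hV
    (by rw [Real.le_log_iff_exp_le hX0]; exact hX) hVI hG ?_ ?_ ?_ ?_ ?_
  · rw [← hsum] at key; linarith
  · intro m hm
    have h1 := hA _ (hBA _ (hF' m hm)).1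
    push_cast at h1
    rw [div_le_iff₀ hq0, div_mul_eq_mul_div, le_div_iff₀ hq0, ← hNT]
    constructor <;> linarith
  · intro m hm
    have h1 := (hBA _ (hF' m hm)).1
    refine (Nat.cast_le.mpr (cardFactors_le_of_dvd ?_ (dvd_mul_left m q))).trans (hΩ _ h1)
    intro h0
    have := (hA _ h1).1
    rw [h0] at this; simp at this; linarith
  · intro m hm
    exact (Int.natCast_dvd_natCast.mpr (dvd_mul_left m q)).trans (hy m hm).2
  · intro m hm m' hm' d hd hd' hdX
    have h1 := hy m hm
    have h2 := hy m' hm'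
    have h3 : ((q * d : ℕ) : ℤ) ∣ y m - y m' :=
      dvd_sub ((Int.natCast_dvd_natCast.mpr (mul_dvd_mul_left q hd)).trans h1.2)
        ((Int.natCast_dvd_natCast.mpr (mul_dvd_mul_left q hd')).trans h2.2)
    have h4 : |((y m - y m' : ℤ) : ℝ)| ≤ K := by
      have h5 := abs_le.mp h1.1
      have h6 := abs_le.mp h2.1
      push_cast
      rw [abs_le]; constructor <;> linarith
    have h5 : K < ((q * d : ℕ) : ℝ) := by
      push_cast
      have h6 : M * Real.exp (-(V / 2)) ≤ q * d := by
        rw [div_mul_eq_mul_div, div_le_iff₀ hq0] at hdX; linarith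
      refine lt_of_lt_of_le (lt_of_le_of_lt hK ?_) h6
      gcongr
      linarith
    have h6 := Int.eq_zero_of_abs_lt_dvd h3 (by
      have : |((y m - y m' : ℤ) : ℝ)| < ((q * d : ℕ) : ℝ) := lt_of_le_of_lt h4 h5
      exact_mod_cast this)
    linarith
  · intro m hm
    exact hcon (y m) (hy m hm).1
      ((Int.natCast_dvd_natCast.mpr (dvd_mul_right q m)).trans (hy m hm).2)

/-- For `x ≠ y`, the primes dividing both `x` and `y` divide `x - y`, so their Euler product is only
`O(log log |x - y|)`, and the product of the weights is at most that times the full Euler product.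
-/
theorem smoothWeight_mul_le {V k Y : ℝ} (hk : 0 < k) (hV : 2 * k ≤ V) (hY : 2 ≤ Y) {x y : ℤ}
    (hxy : x ≠ y) (hd : Real.log |(x : ℝ) - y| ≤ Y) :
    smoothWeight V k x * smoothWeight V k y ≤
      Real.exp 28 * (1 + V / (2 * k)) * (1 + Real.log Y) := by
  unfold smoothWeight
  set n := ⌊Real.exp (V / (2 * k))⌋₊ with hn
  have h1 : 1 ≤ V / (2 * k) := by rw [le_div_iff₀ (by positivity)]; linarith
  have hn2 : 2 ≤ n := Nat.le_floor (by
    push_cast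
    have := Real.exp_one_gt_d9
    have := Real.exp_le_exp.mpr h1
    linarith)
  have hne : (n : ℝ) ≤ Real.exp (V / (2 * k)) := Nat.floor_le (by positivity)
  have hlogn : Real.log n ≤ V / (2 * k) := by
    rw [Real.log_le_iff_le_exp (by positivity)]; exact hne
  rw [← eulerProd_union_mul_inter]
  have h2 : eulerProd (filter (fun p : ℕ => (p : ℤ) ∣ x) (range (n + 1)) ∪
      filter (fun p : ℕ => (p : ℤ) ∣ y) (range (n + 1))) ≤ Real.exp 12 * (1 + V / (2 * k)) := by
    refine (eulerProd_mono (union_subset (filter_subset _ _) (filter_subset _ _))).trans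
      ((eulerProd_range_le hn2).trans ?_)
    gcongr
  have hd0 : (x - y).natAbs ≠ 0 := by
    rw [Int.natAbs_ne_zero]; exact sub_ne_zero.mpr hxy
  have h3 : eulerProd (filter (fun p : ℕ => (p : ℤ) ∣ x) (range (n + 1)) ∩
      filter (fun p : ℕ => (p : ℤ) ∣ y) (range (n + 1))) ≤ Real.exp 16 * (1 + Real.log Y) := by
    have hP : eulerProd (filter (fun p : ℕ => (p : ℤ) ∣ x) (range (n + 1)) ∩
      filter (fun p : ℕ => (p : ℤ) ∣ y) (range (n + 1))) ≤
        eulerProd (x - y).natAbs.primeFactors := by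
      unfold eulerProd
      apply Finset.prod_le_prod_of_subset_of_one_le
      · intro p hp
        obtain ⟨hp1, hp2⟩ := mem_filter.mp hp
        obtain ⟨hp3, hp4⟩ := mem_inter.mp hp1
        have hp5 := dvd_sub (mem_filter.mp hp3).2 (mem_filter.mp hp4).2
        rw [mem_filter, Nat.mem_primeFactors]
        exact ⟨⟨hp2, Int.natCast_dvd.mp hp5, hd0⟩, hp2⟩
      · intro p hp
        exact zero_le_one.trans (one_le_inv_one_sub_inv (mem_filter.mp hp).2)
      · intro p hp _
        exact one_le_inv_one_sub_inv (mem_filter.mp hp).2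
    refine hP.trans (eulerProd_primeFactors_le hd0 ?_ hY)
    rw [Nat.cast_natAbs]
    push_cast
    exact hd
  calc _ ≤ (Real.exp 12 * (1 + V / (2 * k))) * (Real.exp 16 * (1 + Real.log Y)) := by
        apply mul_le_mul h2 h3 (zero_le_one.trans (one_le_eulerProd _)) (by positivity)
    _ = _ := by
        rw [show (28 : ℝ) = 12 + 16 by norm_num, Real.exp_add]; ring

open Classical in
/-- All the prime powers `q ∈ D` for which `A_q` has a large part dividing integers near `h` divide
one and the same integer near `h`, because two distinct integers near `h` cannot both have weight
larger than `G`. -/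
theorem exists_common_multiple (A D : Finset ℕ) (I : ℕ) (h : ℤ) {N M K T V k G c Y : ℝ}
    (hM : 0 < M) (hA : ∀ n ∈ A, M ≤ (n : ℝ) ∧ (n : ℝ) ≤ N)
    (hΩ : ∀ n ∈ A, (ArithmeticFunction.cardFactors n : ℝ) ≤ k)
    (hNT : N = M * Real.exp T) (hT : 1 ≤ T)
    (hk : 1 ≤ k) (hV : 2 * k ≤ V) (hVI : V ≤ 2 ^ I) (hK0 : 0 ≤ K) (hK : K ≤ M * Real.exp (-V))
    (hY : 2 ≤ Y) (hKY : Real.log K ≤ Y)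
    (hG : 0 ≤ G) (hGc : (I + 1) * (2304 * Real.exp 12 * k ^ 3 * G * T / V) < c)
    (hG2 : Real.exp 28 * (1 + V / (2 * k)) * (1 + Real.log Y) ≤ G ^ 2)
    (hD : ∀ q ∈ D, 0 < q ∧ (q : ℝ) ≤ K ∧ q * Real.exp T ≤ M ∧
      c ≤ q * ∑ n ∈ (multiplesIn A q).filter (DividesNear K h), 1 / (n : ℝ)) :
    ∃ x : ℤ, |(x : ℝ) - h| ≤ K / 2 ∧ ∀ q ∈ D, (q : ℤ) ∣ x := by
  have hex : ∀ q ∈ D, ∃ x : ℤ, |(x : ℝ) - h| ≤ K / 2 ∧ (q : ℤ) ∣ x ∧ G < smoothWeight V k x := by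
    intro q hq
    obtain ⟨h1, h2, h3, h4⟩ := hD q hq
    exact exists_multiple_smoothWeight A I q h hM h1 hA hΩ hNT hT h3 hk (by linarith) hVI h2 hK hG
      hGc h4
  rcases D.eq_empty_or_nonempty with rfl | ⟨q₀, hq₀⟩
  · exact ⟨h, by rw [sub_self, abs_zero]; linarith, by simp⟩
  · obtain ⟨x, hx, hqx, hGx⟩ := hex q₀ hq₀
    refine ⟨x, hx, fun q hq => ?_⟩
    obtain ⟨y, hy, hqy, hGy⟩ := hex q hq
    suffices hxy : x = y by rw [hxy]; exact hqy
    by_contra hne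
    have hd : Real.log |(x : ℝ) - y| ≤ Y := by
      refine (Real.log_le_log ?_ ?_).trans hKY
      · have : (x : ℝ) - y ≠ 0 := sub_ne_zero.mpr (by exact_mod_cast hne)
        positivity
      · have h5 := abs_le.mp hx
        have h6 := abs_le.mp hy
        rw [abs_le]; constructor <;> linarith
    have h1 := smoothWeight_mul_le (by linarith) hV hY hne hd
    have h2 : G ^ 2 < smoothWeight V k x * smoothWeight V k y := by
      rw [sq]; exact mul_lt_mul'' hGx hGy hG hG
    linarith

/-! ### Random subsets: characteristic functions and large deviations -/

/-- The probability of the subset `B` of `A` when each element of `A` is chosen independently with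
probability `p`. -/
noncomputable def weight (p : ℝ) (A B : Finset ℕ) : ℝ := p ^ B.card * (1 - p) ^ (A \ B).card

theorem weight_nonneg {p : ℝ} (hp0 : 0 ≤ p) (hp1 : p ≤ 1) (A B : Finset ℕ) : 0 ≤ weight p A B := by
  unfold weight
  have : 0 ≤ 1 - p := by linarith
  positivity

/-- The moment generating function `𝔼 exp (u (X - p))` of a centred Bernoulli variable `X` with
`ℙ(X = 1) = p`. It is used at real `u` for the Chernoff bound, and at imaginary `u`, where it is a
characteristic function. -/
noncomputable def factor (p : ℝ) (u : ℂ) : ℂ :=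
  (1 - p) * Complex.exp (-(p * u)) + p * Complex.exp ((1 - p) * u)

theorem sum_weight_mul_exp (p : ℝ) (A : Finset ℕ) (c : ℂ) :
    ∑ B ∈ A.powerset, (weight p A B : ℂ) * Complex.exp (c * ((R B - p * R A : ℝ) : ℂ)) =
      ∏ n ∈ A, factor p (c / n) := by
  unfold factor
  simp_rw [add_comm ((1 - (p : ℂ)) * _) _]
  rw [prod_add]
  apply sum_congr rfl
  intro B hB
  have hBA := mem_powerset.mp hB
  rw [prod_mul_distrib, prod_mul_distrib, prod_const, prod_const, ← Complex.exp_sum,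
    ← Complex.exp_sum]
  unfold weight
  push_cast
  rw [show ∀ a b d e : ℂ, a * b * (d * e) = (a * d) * (b * e) by intros; ring, ← Complex.exp_add]
  congr 2
  have hR : R A = ∑ n ∈ A \ B, 1 / (n : ℝ) + ∑ n ∈ B, 1 / (n : ℝ) := by
    unfold R; rw [sum_sdiff hBA]
  rw [hR]
  unfold R
  push_cast
  have e1 : ∀ s : Finset ℕ, ∑ n ∈ s, (1 - (p : ℂ)) * (c / n) =
      (1 - p) * c * ∑ n ∈ s, 1 / (n : ℂ) := by
    intro s; rw [mul_sum]; exact sum_congr rfl fun n _ => by ring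
  have e2 : ∀ s : Finset ℕ, ∑ n ∈ s, -((p : ℂ) * (c / n)) = -(p * c * ∑ n ∈ s, 1 / (n : ℂ)) := by
    intro s; rw [mul_sum, ← sum_neg_distrib]; exact sum_congr rfl fun n _ => by ring
  rw [e1, e2]
  ring

theorem factor_ofReal_mul_I (p t : ℝ) : factor p (t * Complex.I) =
    ((1 - p) * Real.cos (p * t) + p * Real.cos ((1 - p) * t) : ℝ) +
      (-((1 - p) * Real.sin (p * t)) + p * Real.sin ((1 - p) * t) : ℝ) * Complex.I := by
  unfold factor
  rw [show -((p : ℂ) * (t * Complex.I)) = ((-(p * t) : ℝ) : ℂ) * Complex.I by push_cast; ring,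
    show (1 - (p : ℂ)) * (t * Complex.I) = (((1 - p) * t : ℝ) : ℂ) * Complex.I by push_cast; ring,
    Complex.exp_ofReal_mul_I, Complex.exp_ofReal_mul_I, Real.cos_neg, Real.sin_neg]
  push_cast
  ring

/-- The squared absolute value of the factor is `1 - 2 p (1 - p) (1 - cos t)`. -/
theorem norm_factor_le {p : ℝ} (t : ℝ) :
    ‖factor p (t * Complex.I)‖ ≤ Real.exp (-(p * (1 - p) * (1 - Real.cos t))) := by
  have h : ‖factor p (t * Complex.I)‖ ^ 2 = 1 - 2 * (p * (1 - p) * (1 - Real.cos t)) := by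
    rw [factor_ofReal_mul_I, Complex.sq_norm, Complex.normSq_add_mul_I]
    have h1 : Real.cos t = Real.cos (p * t) * Real.cos ((1 - p) * t) -
        Real.sin (p * t) * Real.sin ((1 - p) * t) := by
      rw [← Real.cos_add]; congr 1; ring
    rw [h1]
    have h2 := Real.sin_sq_add_cos_sq (p * t)
    have h3 := Real.sin_sq_add_cos_sq ((1 - p) * t)
    linear_combination (1 - p) ^ 2 * h2 + p ^ 2 * h3
  refine abs_le_of_sq_le_sq' ?_ (by positivity) |>.2
  rw [h, ← Real.exp_nat_mul]
  have := Real.add_one_le_exp (((2 : ℕ) : ℝ) * -(p * (1 - p) * (1 - Real.cos t)))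
  push_cast at this ⊢
  linarith

/-- If `θ` is at distance at least `ρ` from all integers, then `1 - cos (2πθ) ≥ 8 ρ²`. -/
theorem eight_mul_sq_le_one_sub_cos {θ ρ : ℝ} (hρ : 0 ≤ ρ) (h : ∀ j : ℤ, ρ ≤ |θ - j|) :
    8 * ρ ^ 2 ≤ 1 - Real.cos (2 * Real.pi * θ) := by
  set u := θ - round θ with hu
  have h1 : ρ ≤ |u| := h (round θ)
  have h2 : |u| ≤ 1 / 2 := abs_sub_round θ
  have h3 : Real.cos (2 * Real.pi * θ) = Real.cos (2 * Real.pi * |u|) := by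
    have : 2 * Real.pi * θ = 2 * Real.pi * u + (round θ : ℤ) * (2 * Real.pi) := by
      rw [hu]; ring
    rw [this, Real.cos_add_int_mul_two_pi, ← Real.cos_abs, abs_mul, abs_of_pos Real.two_pi_pos]
  rw [h3, show 2 * Real.pi * |u| = 2 * (Real.pi * |u|) by ring, Real.cos_two_mul]
  have h4 := Real.sin_sq_add_cos_sq (Real.pi * |u|)
  have h5 := Real.mul_le_sin (x := Real.pi * |u|) (by positivity) (by
    have := Real.pi_pos; nlinarith)
  have h6 : 2 / Real.pi * (Real.pi * |u|) = 2 * |u| := by field_simp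
  rw [h6] at h5
  nlinarith [abs_nonneg u]

theorem norm_factor_le_one {p : ℝ} (hp0 : 0 ≤ p) (hp1 : p ≤ 1) (t : ℝ) :
    ‖factor p (t * Complex.I)‖ ≤ 1 := by
  refine (norm_factor_le t).trans (Real.exp_le_one_iff.mpr ?_)
  have := Real.cos_le_one t
  have : 0 ≤ p * (1 - p) * (1 - Real.cos t) :=
    mul_nonneg (mul_nonneg hp0 (by linarith)) (by linarith)
  linarith

theorem abs_sin_sub_self_le {u : ℝ} (hu : |u| ≤ 1) : |Real.sin u - u| ≤ |u| ^ 3 / 4 := by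
  have h := abs_le.mp (Real.sin_bound hu)
  have h4 : |u| ^ 5 ≤ |u| ^ 3 := pow_le_pow_of_le_one (abs_nonneg u) hu (by norm_num)
  have h3 := abs_le.mp (le_of_eq (abs_pow u 3))
  have h0 : 0 ≤ |u| ^ 3 := by positivity
  rw [abs_le]
  constructor <;> linarith [h.1, h.2, h3.1, h3.2]

/-- The factors have real part at least `1/2` and, being centred, an imaginary part of third order.
So if `|A| τ³ ≤ 1/2`, the argument of their product stays small enough for the real part of the
product to be nonnegative. -/
theorem re_prod_factor_nonneg {p : ℝ} (hp0 : 0 ≤ p) (hp1 : p ≤ 1) (A : Finset ℕ) (t : ℕ → ℝ)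
    {τ : ℝ} (hτ : τ ≤ 1) (ht : ∀ n ∈ A, |t n| ≤ τ) (hA : A.card * τ ^ 3 ≤ 1 / 2) :
    0 ≤ (∏ n ∈ A, factor p (t n * Complex.I)).re := by
  set r : ℕ → ℝ := fun n => (1 - p) * Real.cos (p * t n) + p * Real.cos ((1 - p) * t n) with hr
  set s : ℕ → ℝ := fun n => -((1 - p) * Real.sin (p * t n)) + p * Real.sin ((1 - p) * t n) with hs
  set z : ℕ → ℂ := fun n => ((s n / r n : ℝ) : ℂ) * Complex.I with hz
  have hq0 : 0 ≤ 1 - p := by linarith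
  have hr2 : ∀ n ∈ A, 1 / 2 ≤ r n := by
    intro n hn
    have ht1 := (ht n hn).trans hτ
    have ht2 : t n ^ 2 ≤ 1 := by rw [← sq_abs]; nlinarith [abs_nonneg (t n)]
    have h1 := Real.one_sub_sq_div_two_le_cos (x := p * t n)
    have h2 := Real.one_sub_sq_div_two_le_cos (x := (1 - p) * t n)
    have h3 : (p * t n) ^ 2 ≤ 1 := by
      rw [mul_pow]; exact mul_le_one₀ (pow_le_one₀ hp0 hp1) (sq_nonneg _) ht2
    have h4 : ((1 - p) * t n) ^ 2 ≤ 1 := by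
      rw [mul_pow]; exact mul_le_one₀ (pow_le_one₀ hq0 (by linarith)) (sq_nonneg _) ht2
    have h5 : (1 - p) * (1 / 2) ≤ (1 - p) * Real.cos (p * t n) :=
      mul_le_mul_of_nonneg_left (by linarith) hq0
    have h6 : p * (1 / 2) ≤ p * Real.cos ((1 - p) * t n) :=
      mul_le_mul_of_nonneg_left (by linarith) hp0
    simp only [hr]; linarith
  have hs2 : ∀ n ∈ A, |s n| ≤ τ ^ 3 / 2 := by
    intro n hn
    have ht1 := (ht n hn).trans hτ
    have hb : ∀ c : ℝ, 0 ≤ c → c ≤ 1 → |Real.sin (c * t n) - c * t n| ≤ τ ^ 3 / 4 := by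
      intro c hc0 hc1
      have h1 : |c * t n| ≤ |t n| := by
        rw [abs_mul, abs_of_nonneg hc0]
        exact mul_le_of_le_one_left (abs_nonneg _) hc1
      refine (abs_sin_sub_self_le (h1.trans ht1)).trans ?_
      have := pow_le_pow_left₀ (abs_nonneg _) (h1.trans (ht n hn)) 3
      linarith
    have h1 := abs_le.mp (hb p hp0 hp1)
    have h2 := abs_le.mp (hb (1 - p) hq0 (by linarith))
    have h0 : 0 ≤ τ ^ 3 / 4 := (abs_nonneg _).trans (hb p hp0 hp1)
    have hs' : s n = -((1 - p) * (Real.sin (p * t n) - p * t n)) +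
        p * (Real.sin ((1 - p) * t n) - (1 - p) * t n) := by simp only [hs]; ring
    rw [hs', abs_le]
    constructor <;> nlinarith
  have hfac : ∀ n ∈ A, factor p (t n * Complex.I) = (r n : ℂ) * (1 + z n) := by
    intro n hn
    have h0 : (r n : ℂ) ≠ 0 := by
      exact_mod_cast (by linarith [hr2 n hn] : 0 < r n).ne'
    rw [factor_ofReal_mul_I, hz]
    simp only
    push_cast
    field_simp
    simp only [hr, hs]
    push_cast
    ring
  rw [prod_congr rfl hfac, prod_mul_distrib, ← Complex.ofReal_prod, Complex.re_ofReal_mul]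
  refine mul_nonneg (prod_nonneg fun n hn => by linarith [hr2 n hn]) ?_
  have hn := Finset.norm_prod_one_add_sub_one_le A z
  have hsum : ∑ n ∈ A, ‖z n‖ ≤ 1 / 2 := by
    calc _ ≤ ∑ n ∈ A, τ ^ 3 := by
          apply sum_le_sum
          intro n hn
          simp only [hz]
          rw [norm_mul, Complex.norm_I, mul_one, Complex.norm_real, Real.norm_eq_abs, abs_div,
            abs_of_pos (by linarith [hr2 n hn] : 0 < r n), div_le_iff₀ (by linarith [hr2 n hn])]
          have := hs2 n hn
          have := hr2 n hn
          nlinarith [abs_nonneg (s n)]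
      _ ≤ _ := by simpa using hA
  have h1 : Real.exp (∑ n ∈ A, ‖z n‖) - 1 ≤ 1 := by
    have h2 := Real.exp_le_exp.mpr hsum
    have h3 : Real.exp (1 / 2) ^ 2 = Real.exp 1 := by rw [← Real.exp_nat_mul]; norm_num
    nlinarith [Real.exp_one_lt_d9, Real.exp_pos (1 / 2)]
  have h2 := (Complex.abs_re_le_norm (∏ n ∈ A, (1 + z n) - 1)).trans (hn.trans h1)
  rw [Complex.sub_re, Complex.one_re] at h2
  linarith [(abs_le.mp h2).1]

theorem factor_real_le {p u : ℝ} (hp0 : 0 ≤ p) (hp1 : p ≤ 1) (hu : |u| ≤ 1) :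
    (1 - p) * Real.exp (-(p * u)) + p * Real.exp ((1 - p) * u) ≤ Real.exp (u ^ 2) := by
  have hq0 : 0 ≤ 1 - p := by linarith
  have hb : ∀ v : ℝ, |v| ≤ 1 → Real.exp v ≤ 1 + v + v ^ 2 := fun v hv => by
    have := (abs_le.mp (Real.abs_exp_sub_one_sub_id_le hv)).2
    linarith
  have h1 := hb (-(p * u)) (by
    rw [abs_neg, abs_mul, abs_of_nonneg hp0]; exact mul_le_one₀ hp1 (abs_nonneg _) hu)
  have h2 := hb ((1 - p) * u) (by
    rw [abs_mul, abs_of_nonneg hq0]; exact mul_le_one₀ (by linarith) (abs_nonneg _) hu)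
  have h3 := Real.add_one_le_exp (u ^ 2)
  have h4 := mul_le_mul_of_nonneg_left h1 hq0
  have h5 := mul_le_mul_of_nonneg_left h2 hp0
  have h6 : (1 - p) * (1 + -(p * u) + (-(p * u)) ^ 2) + p * (1 + (1 - p) * u + ((1 - p) * u) ^ 2)
    = 1 + p * (1 - p) * u ^ 2 := by ring
  have h7 : p * (1 - p) * u ^ 2 ≤ 1 * u ^ 2 :=
    mul_le_mul_of_nonneg_right (by nlinarith) (sq_nonneg u)
  linarith

theorem sum_weight_mul_exp_real_le {p M : ℝ} (hp0 : 0 ≤ p) (hp1 : p ≤ 1) (A : Finset ℕ)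
    (hM : 0 < M) (hA : ∀ n ∈ A, M ≤ (n : ℝ)) {c : ℝ} (hc : |c| ≤ M) :
    ∑ B ∈ A.powerset, weight p A B * Real.exp (c * (R B - p * R A)) ≤
      Real.exp (A.card * (c ^ 2 / M ^ 2)) := by
  have h := sum_weight_mul_exp p A (c : ℂ)
  have h1 : ∑ B ∈ A.powerset, weight p A B * Real.exp (c * (R B - p * R A)) =
      ∏ n ∈ A, ((1 - p) * Real.exp (-(p * (c / n))) + p * Real.exp ((1 - p) * (c / n))) := by
    have : ((∑ B ∈ A.powerset, weight p A B * Real.exp (c * (R B - p * R A)) : ℝ) : ℂ) =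
      ((∏ n ∈ A, ((1 - p) * Real.exp (-(p * (c / n))) +
        p * Real.exp ((1 - p) * (c / n))) : ℝ) : ℂ) := by
      unfold factor at h
      push_cast at h ⊢
      exact h
    exact_mod_cast this
  rw [h1]
  calc _ ≤ ∏ n ∈ A, Real.exp (c ^ 2 / M ^ 2) := by
        apply prod_le_prod
        · intro n _
          have : 0 ≤ 1 - p := by linarith
          positivity
        · intro n hn
          have hn0 : 0 < (n : ℝ) := hM.trans_le (hA n hn)
          refine (factor_real_le hp0 hp1 ?_).trans ?_
          · rw [abs_div, abs_of_pos hn0, div_le_one hn0]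
            exact hc.trans (hA n hn)
          · rw [div_pow]
            have := hA n hn
            have := sq_abs c
            gcongr
    _ = _ := by rw [prod_const, ← Real.exp_nat_mul]

/-- Chernoff's bound: `R(B)` differs from its mean `p R(A)` by at least `1` with probability at most
`2 exp (-M² / (4N))`. -/
theorem sum_weight_tail_le {p M N : ℝ} (hp0 : 0 ≤ p) (hp1 : p ≤ 1) (A : Finset ℕ)
    (hM : 0 < M) (hMN : M ≤ N) (hA : ∀ n ∈ A, M ≤ (n : ℝ)) (hcard : (A.card : ℝ) ≤ N) :
    ∑ B ∈ A.powerset.filter (fun B => 1 ≤ |R B - p * R A|), weight p A B ≤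
      2 * Real.exp (-(M ^ 2 / (4 * N))) := by
  -- The exponent `c` that optimises `exp (-c + N c² / M²)`.
  set c := M ^ 2 / (2 * N) with hc
  have hN : 0 < N := by linarith
  have hc0 : 0 ≤ c := by positivity
  have hcM : c ≤ M := by rw [hc, div_le_iff₀ (by positivity)]; nlinarith
  have hexp : A.card * (c ^ 2 / M ^ 2) ≤ M ^ 2 / (4 * N) := by
    calc _ ≤ N * (c ^ 2 / M ^ 2) := by gcongr
      _ = _ := by rw [hc]; field_simp; ring
  have h1 := (sum_weight_mul_exp_real_le hp0 hp1 A hM hA (c := c)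
    (by rwa [abs_of_nonneg hc0])).trans
    (Real.exp_le_exp.mpr hexp)
  have h2 := (sum_weight_mul_exp_real_le hp0 hp1 A hM hA (c := -c)
    (by rwa [abs_neg, abs_of_nonneg hc0])).trans
    (show _ ≤ Real.exp (M ^ 2 / (4 * N)) by rw [neg_sq]; exact Real.exp_le_exp.mpr hexp)
  have h3 : ∑ B ∈ A.powerset.filter (fun B => 1 ≤ |R B - p * R A|), weight p A B ≤
      Real.exp (-c) * ∑ B ∈ A.powerset, weight p A B *
        (Real.exp (c * (R B - p * R A)) + Real.exp (-c * (R B - p * R A))) := by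
    rw [mul_sum]
    refine (sum_le_sum fun B hB => ?_).trans
      (sum_le_sum_of_subset_of_nonneg (filter_subset _ _) fun B _ _ => ?_)
    · have hB1 := (mem_filter.mp hB).2
      set Y := R B - p * R A
      have hw := weight_nonneg hp0 hp1 A B
      have h4 : 1 ≤ Real.exp (-c) * (Real.exp (c * Y) + Real.exp (-c * Y)) := by
        rw [mul_add, ← Real.exp_add, ← Real.exp_add]
        rcases le_abs.mp hB1 with h | h
        · have : 1 ≤ Real.exp (-c + c * Y) := Real.one_le_exp (by nlinarith)
          have := Real.exp_pos (-c + -c * Y)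
          linarith
        · have : 1 ≤ Real.exp (-c + -c * Y) := Real.one_le_exp (by nlinarith)
          have := Real.exp_pos (-c + c * Y)
          linarith
      nlinarith
    · have := weight_nonneg hp0 hp1 A B
      positivity
  refine h3.trans ?_
  simp_rw [mul_add (weight p A _)]
  rw [sum_add_distrib]
  calc _ ≤ Real.exp (-c) * (Real.exp (M ^ 2 / (4 * N)) + Real.exp (M ^ 2 / (4 * N))) := by gcongr
    _ = 2 * (Real.exp (-c) * Real.exp (M ^ 2 / (4 * N))) := by ring
    _ = _ := by
        rw [← Real.exp_add]; congr 2; rw [hc]; field_simp; ring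

/-! ### Fourier inversion on the integers modulo `Q` -/

/-- Orthogonality of additive characters, over an arbitrary interval of `Q` consecutive integers. -/
theorem sum_Ico_exp {Q : ℕ} (hQ : 0 < Q) (a t : ℤ) (ht : ¬ (Q : ℤ) ∣ t) :
    ∑ h ∈ Ico a (a + Q), Complex.exp (2 * Real.pi * Complex.I * h * (t / Q)) = 0 := by
  have hQ0 : (Q : ℂ) ≠ 0 := by exact_mod_cast hQ.ne'
  set ζ := Complex.exp (2 * Real.pi * Complex.I * (t / Q)) with hζ
  have h1 : ∑ h ∈ Ico a (a + Q), Complex.exp (2 * Real.pi * Complex.I * h * (t / Q)) =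
      ∑ j ∈ range Q, Complex.exp (2 * Real.pi * Complex.I * a * (t / Q)) * ζ ^ j := by
    refine sum_nbij' (fun h => (h - a).toNat) (fun j => a + j) ?_ ?_ ?_ ?_ ?_
    · intro h hh; rw [mem_Ico] at hh; rw [mem_range]; omega
    · intro j hj; rw [mem_range] at hj; rw [mem_Ico]; omega
    · intro h hh; rw [mem_Ico] at hh; omega
    · intro j hj; simp
    · intro h hh
      rw [mem_Ico] at hh
      obtain ⟨j, rfl⟩ : ∃ j : ℕ, h = a + j := ⟨(h - a).toNat, by omega⟩
      rw [hζ, ← Complex.exp_nat_mul, ← Complex.exp_add]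
      congr 1
      rw [show (a + (j : ℤ) - a).toNat = j by omega]
      push_cast
      ring
  rw [h1, ← mul_sum]
  have hζ1 : ζ ≠ 1 := by
    rw [hζ, Ne, Complex.exp_eq_one_iff]
    rintro ⟨n, hn⟩
    apply ht
    refine ⟨n, ?_⟩
    have hpi : (2 * Real.pi * Complex.I : ℂ) ≠ 0 := Complex.two_pi_I_ne_zero
    rw [mul_comm (n : ℂ)] at hn
    have := mul_left_cancel₀ hpi hn
    rw [div_eq_iff hQ0] at this
    rw [mul_comm]
    exact_mod_cast this
  have hζQ : ζ ^ Q = 1 := by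
    rw [hζ, ← Complex.exp_nat_mul, Complex.exp_eq_one_iff]
    exact ⟨t, by field_simp⟩
  have h2 := mul_geom_sum ζ Q
  rw [hζQ, sub_self, mul_eq_zero] at h2
  rw [h2.resolve_left (sub_ne_zero.mpr hζ1), mul_zero]

/-- If every subset `B` had `R(B) ≠ x / Q`, then the sum of the characteristic function over a full
set of residues `h` modulo `Q` would be `Q` times the probability that `R(B) - x / Q` is a nonzero
integer, which is at most the probability that `|R(B) - x / Q| ≥ 1`. -/
theorem exists_subset_of_fourier (A : Finset ℕ) {Q : ℕ} (hQ : 0 < Q) (hAQ : ∀ n ∈ A, n ∣ Q)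
    {p : ℝ} (hp0 : 0 ≤ p) (hp1 : p ≤ 1) (x : ℕ) (hp : p * R A = x / Q) (a : ℤ)
    (hmain : 1 / 2 ≤ (∑ h ∈ Ico a (a + Q),
      ∏ n ∈ A, factor p ((2 * Real.pi * (h / n) : ℝ) * Complex.I)).re)
    (htail : Q * ∑ B ∈ A.powerset.filter (fun B => 1 ≤ |R B - p * R A|), weight p A B < 1 / 2) :
    ∃ B : Finset ℕ, B ⊆ A ∧ R B = x / Q := by
  by_contra! hcon
  have hQ0 : (0 : ℝ) < Q := by exact_mod_cast hQ
  -- All sums `R(B)` are integer multiples of `1 / Q`.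
  have hint : ∀ B ∈ A.powerset, ∃ t : ℤ, R B - p * R A = t / Q := by
    intro B hB
    refine ⟨((∑ n ∈ B, Q / n : ℕ) : ℤ) - (x : ℤ), ?_⟩
    rw [hp, Int.cast_sub, Int.cast_natCast, Int.cast_natCast, Nat.cast_sum, sub_div, sum_div]
    congr 1
    unfold R
    apply sum_congr rfl
    intro n hn
    obtain ⟨c, rfl⟩ := hAQ n (mem_powerset.mp hB hn)
    have hn0 : 0 < n := Nat.pos_of_mul_pos_right hQ
    have hc0 : 0 < c := Nat.pos_of_mul_pos_left hQ
    rw [Nat.mul_div_cancel_left c hn0]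
    push_cast
    field_simp
  have h1 : ∑ h ∈ Ico a (a + Q), ∏ n ∈ A, factor p ((2 * Real.pi * (h / n) : ℝ) * Complex.I) =
      ∑ B ∈ A.powerset, (weight p A B : ℂ) * ∑ h ∈ Ico a (a + Q),
        Complex.exp (2 * Real.pi * Complex.I * h * ((R B - p * R A : ℝ) : ℂ)) := by
    simp_rw [mul_sum]
    rw [sum_comm]
    apply sum_congr rfl
    intro h _
    rw [sum_weight_mul_exp]
    apply prod_congr rfl
    intro n _
    congr 1
    push_cast
    ring
  have h2 : (∑ h ∈ Ico a (a + Q), ∏ n ∈ A,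
      factor p ((2 * Real.pi * (h / n) : ℝ) * Complex.I)).re ≤
      Q * ∑ B ∈ A.powerset.filter (fun B => 1 ≤ |R B - p * R A|), weight p A B := by
    refine (Complex.re_le_norm _).trans ?_
    rw [h1, mul_sum, sum_filter]
    refine (norm_sum_le _ _).trans (sum_le_sum fun B hB => ?_)
    have hw := weight_nonneg hp0 hp1 A B
    rw [norm_mul, Complex.norm_real, Real.norm_of_nonneg hw]
    obtain ⟨t, ht⟩ := hint B hB
    by_cases hd : (Q : ℤ) ∣ t
    · have ht0 : t ≠ 0 := by
        rintro rfl
        refine hcon B (mem_powerset.mp hB) ?_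
        rw [← hp]; simp at ht; linarith
      have h3 : 1 ≤ |R B - p * R A| := by
        rw [ht, abs_div, abs_of_pos hQ0, one_le_div hQ0]
        have := Int.le_of_dvd (abs_pos.mpr ht0) ((dvd_abs _ _).mpr hd)
        exact_mod_cast this
      rw [if_pos h3, mul_comm (Q : ℝ)]
      refine mul_le_mul_of_nonneg_left ?_ hw
      refine (norm_sum_le _ _).trans ?_
      calc _ ≤ ∑ h ∈ Ico a (a + Q), (1 : ℝ) := by
            apply sum_le_sum
            intro h _
            rw [show 2 * (Real.pi : ℂ) * Complex.I * h * ((R B - p * R A : ℝ) : ℂ) =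
              ((2 * Real.pi * h * (R B - p * R A) : ℝ) : ℂ) * Complex.I by push_cast; ring,
              Complex.norm_exp_ofReal_mul_I]
        _ = Q := by simp
    · have h3 := sum_Ico_exp hQ a t hd
      have h4 : ((R B - p * R A : ℝ) : ℂ) = (t : ℂ) / Q := by rw [ht]; push_cast; rfl
      rw [h4, h3]
      simp only [norm_zero, mul_zero]
      split_ifs <;> positivity
  linarith

/-! ### Frequencies far from zero -/

/-- The number of prime powers `p ^ j`, `j ≥ 1`, that divide `n` is at most `Ω(n)`. -/
theorem card_primePow_dvd_le {n : ℕ} (hn : n ≠ 0) (T : Finset ℕ)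
    (hT : ∀ q ∈ T, IsPrimePow q ∧ q ∣ n) : T.card ≤ ArithmeticFunction.cardFactors n := by
  have hsub : T ⊆ n.primeFactors.biUnion fun p => (Icc 1 (n.factorization p)).image (p ^ ·) := by
    intro q hq
    obtain ⟨hpp, hd⟩ := hT q hq
    obtain ⟨p, k, hp, hk, rfl⟩ := (isPrimePow_nat_iff q).mp hpp
    rw [mem_biUnion]
    refine ⟨p, Nat.mem_primeFactors.mpr ⟨hp, (dvd_pow_self p hk.ne').trans hd, hn⟩, ?_⟩
    rw [mem_image]
    exact ⟨k, mem_Icc.mpr ⟨hk, (hp.pow_dvd_iff_le_factorization hn).mp hd⟩, rfl⟩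
  refine (card_le_card hsub).trans (card_biUnion_le.trans ?_)
  rw [ArithmeticFunction.cardFactors_eq_sum_factorization, Finsupp.sum, Nat.support_factorization]
  apply sum_le_sum
  intro p _
  refine card_image_le.trans ?_
  simp

open Classical in
/-- If `n` divides no integer within `K / 2` of `h`, then `h / n` is at distance at least `K / (2N)`
from the integers and the factor at `n` is small. Suppose that for each of the prime powers `q ∈ T`
there are at least `c` such multiples `n ∈ A` of `q`. As each `n` is counted for at most `Ω(n) ≤ k`
different `q`, there are at least `|T| c / k` such `n` in all. -/
theorem norm_prod_factor_le {p : ℝ} (hp0 : 0 ≤ p) (hp1 : p ≤ 1) (A T : Finset ℕ) (h : ℤ)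
    {N K κ c k : ℝ} (hN : 0 < N) (hK : 0 ≤ K) (hκ : κ ≤ p * (1 - p)) (hκ0 : 0 ≤ κ) (hk : 0 < k)
    (hA : ∀ n ∈ A, 0 < n ∧ (n : ℝ) ≤ N)
    (hΩ : ∀ n ∈ A, (ArithmeticFunction.cardFactors n : ℝ) ≤ k)
    (hT : ∀ q ∈ T, IsPrimePow q ∧
      c ≤ ((multiplesIn A q).filter (fun n => ¬ DividesNear K h n)).card) :
    ‖∏ n ∈ A, factor p ((2 * Real.pi * (h / n) : ℝ) * Complex.I)‖ ≤
      Real.exp (-(2 * κ * (K / N) ^ 2 * (c / k))) ^ T.card := by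
  set Z := A.filter (fun n => ¬ DividesNear K h n) with hZ
  have hfar : ∀ n ∈ Z, ‖factor p ((2 * Real.pi * (h / n) : ℝ) * Complex.I)‖ ≤
      Real.exp (-(2 * κ * (K / N) ^ 2)) := by
    intro n hn
    obtain ⟨hnA, hnear⟩ := mem_filter.mp hn
    obtain ⟨hn0, hnN⟩ := hA n hnA
    have hn0' : (0 : ℝ) < n := by exact_mod_cast hn0
    refine (norm_factor_le _).trans (Real.exp_le_exp.mpr (neg_le_neg ?_))
    have h1 := eight_mul_sq_le_one_sub_cos (θ := (h : ℝ) / n) (ρ := K / (2 * N)) (by positivity) ?_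
    · calc _ = κ * (8 * (K / (2 * N)) ^ 2) := by field_simp; ring
        _ ≤ _ := mul_le_mul hκ h1 (by positivity) (hκ0.trans hκ)
    · intro j
      by_contra! hlt
      refine hnear ⟨n * j, ?_, dvd_mul_right _ _⟩
      have h2 : ((n * j : ℤ) : ℝ) - h = -(n * ((h : ℝ) / n - j)) := by
        push_cast; field_simp; ring
      rw [h2, abs_neg, abs_mul, abs_of_pos hn0']
      calc (n : ℝ) * |(h : ℝ) / n - j| ≤ N * (K / (2 * N)) :=
            mul_le_mul hnN hlt.le (abs_nonneg _) hN.le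
        _ = K / 2 := by field_simp
  have hcard : T.card * c ≤ Z.card * k := by
    have h1 : T.card * c ≤ ∑ q ∈ T, (((Z.filter (fun n => q ∣ n)).card : ℕ) : ℝ) := by
      rw [← nsmul_eq_mul, ← sum_const]
      apply sum_le_sum
      intro q hq
      refine (hT q hq).2.trans (Nat.cast_le.mpr (card_le_card fun n hn => ?_))
      obtain ⟨h1, h2⟩ := mem_filter.mp hn
      obtain ⟨h3, h4⟩ := mem_filter.mp h1
      exact mem_filter.mpr ⟨mem_filter.mpr ⟨h3, h2⟩, h4⟩
    have h2 : ∑ q ∈ T, (Z.filter (fun n => q ∣ n)).card =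
        ∑ n ∈ Z, (T.filter (fun q => q ∣ n)).card :=
      sum_card_bipartiteAbove_eq_sum_card_bipartiteBelow (fun q n => q ∣ n)
    refine h1.trans ?_
    rw [← Nat.cast_sum, h2, Nat.cast_sum, ← nsmul_eq_mul, ← sum_const]
    apply sum_le_sum
    intro n hn
    have hnA := (mem_filter.mp hn).1
    refine le_trans (Nat.cast_le.mpr ?_) (hΩ n hnA)
    exact card_primePow_dvd_le (hA n hnA).1.ne' _ fun q hq =>
      ⟨(hT q (mem_filter.mp hq).1).1, (mem_filter.mp hq).2⟩
  rw [norm_prod, ← prod_sdiff (filter_subset _ A : Z ⊆ A)]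
  calc _ ≤ (1 : ℝ) * ∏ n ∈ Z, Real.exp (-(2 * κ * (K / N) ^ 2)) := by
        apply mul_le_mul
        · exact prod_le_one (fun _ _ => norm_nonneg _) fun n _ => norm_factor_le_one hp0 hp1 _
        · exact prod_le_prod (fun _ _ => norm_nonneg _) hfar
        · exact prod_nonneg fun _ _ => norm_nonneg _
        · exact zero_le_one
    _ ≤ _ := by
        rw [one_mul, prod_const, ← Real.exp_nat_mul, ← Real.exp_nat_mul, Real.exp_le_exp]
        have h3 : T.card * (c / k) ≤ Z.card := by
          rw [mul_div_assoc', div_le_iff₀ hk]; exact hcard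
        have h4 : 0 ≤ 2 * κ * (K / N) ^ 2 := by positivity
        nlinarith

/-- Group the frequencies `h` by the set `T = P \ D h` of exceptional prime powers. The hypothesis
`hx` gives a multiple `x` of `lcm (P \ T) ≥ lcm P / ∏_{q ∈ T} q` within `K / 2` of `h` and at most
`lcm P` in absolute value, so at most `3 (K + 1) ∏_{q ∈ T} q` frequencies share the same `T`. As `T`
is never empty, summing the bounds `E ^ |T|` over `T` yields `∏ (1 + E q)` without the term `1`. -/
theorem sum_minor_le (P : Finset ℕ) (hP : ∀ q ∈ P, 0 < q) (H : Finset ℤ) (D : ℤ → Finset ℕ)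
    (f : ℤ → ℝ) {K E : ℝ} (hK : 0 ≤ K) (hE : 0 ≤ E) (hD : ∀ h ∈ H, D h ⊂ P)
    (hf : ∀ h ∈ H, f h ≤ E ^ (P \ D h).card)
    (hx : ∀ h ∈ H, ∃ x : ℤ, |(x : ℝ) - h| ≤ K / 2 ∧ (∀ q ∈ D h, (q : ℤ) ∣ x) ∧
      |x| ≤ (P.lcm id : ℕ)) :
    ∑ h ∈ H, f h ≤ 3 * (K + 1) * (∏ q ∈ P, (1 + E * q) - 1) := by
  have hmaps : ∀ h ∈ H, P \ D h ∈ P.powerset.erase ∅ := by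
    intro h hh
    rw [mem_erase, mem_powerset]
    exact ⟨(sdiff_nonempty.mpr (hD h hh).2).ne_empty, sdiff_subset⟩
  have hcount : ∀ T ∈ P.powerset.erase ∅, ((H.filter (fun h => P \ D h = T)).card : ℝ) ≤
      3 * (K + 1) * ∏ q ∈ T, (q : ℝ) := by
    intro T hT
    have hTP : T ⊆ P := mem_powerset.mp (mem_erase.mp hT).2
    set L := (P \ T).lcm id with hL
    set J := ∏ q ∈ T, q with hJ
    have hJ1 : 1 ≤ J := prod_pos fun q hq => hP q (hTP hq)
    have hL0 : 0 < L := Nat.pos_of_ne_zero (by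
      rw [hL, Ne, Finset.lcm_eq_zero_iff]
      rintro ⟨q, hq, h0⟩
      simp only [id] at h0
      have := hP q (mem_sdiff.mp hq).1
      omega)
    have hQ : P.lcm id ≤ L * J := by
      apply Nat.le_of_dvd (by positivity)
      apply Finset.lcm_dvd
      intro q hq
      by_cases hqT : q ∈ T
      · exact (dvd_prod_of_mem _ hqT).trans (dvd_mul_left _ _)
      · exact (dvd_lcm (f := id) (mem_sdiff.mpr ⟨hq, hqT⟩)).trans (dvd_mul_right _ _)
    have hLx : ∀ h ∈ H.filter (fun h => P \ D h = T), ∃ x : ℤ, |(x : ℝ) - h| ≤ K / 2 ∧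
        (L : ℤ) ∣ x ∧ |x| ≤ (P.lcm id : ℕ) := by
      intro h hh
      obtain ⟨hhH, hhT⟩ := mem_filter.mp hh
      obtain ⟨x, h1, h2, h3⟩ := hx h hhH
      refine ⟨x, h1, ?_, h3⟩
      rw [Int.natCast_dvd]
      apply Finset.lcm_dvd
      intro q hq
      have : q ∈ D h := by
        obtain ⟨hqP, hqT⟩ := mem_sdiff.mp hq
        by_contra hqD
        exact hqT (hhT ▸ mem_sdiff.mpr ⟨hqP, hqD⟩)
      exact Int.natCast_dvd.mp (h2 q this)
    have hex : ∃ X : ℤ → ℤ, ∀ h ∈ H.filter (fun h => P \ D h = T),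
        |(X h : ℝ) - h| ≤ K / 2 ∧ (L : ℤ) ∣ X h ∧ |X h| ≤ (P.lcm id : ℕ) := by
      choose! X hX using hLx
      exact ⟨X, hX⟩
    obtain ⟨X, hX⟩ := hex
    set r : ℕ := ⌊K / 2⌋₊ with hr
    -- `h` is determined by `X h / L` and `X h - h`.
    have hcard : (H.filter (fun h => P \ D h = T)).card ≤
        (Icc (-(J : ℤ)) J ×ˢ Icc (-(r : ℤ)) r).card := by
      apply card_le_card_of_injOn (fun h => (X h / L, X h - h))
      · intro h hh
        obtain ⟨h1, ⟨j, hj⟩, h3⟩ := hX h (mem_coe.mp hh)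
        rw [mem_coe, mem_product, mem_Icc, mem_Icc]
        simp only
        have hL0' : (0 : ℤ) < L := by exact_mod_cast hL0
        rw [hj, Int.mul_ediv_cancel_left _ hL0'.ne', ← abs_le, ← abs_le, ← hj]
        constructor
        · have h4 : |(L : ℤ) * j| ≤ L * J := by
            rw [← hj]; exact h3.trans (by exact_mod_cast hQ)
          rw [abs_mul, abs_of_pos hL0'] at h4
          exact le_of_mul_le_mul_left h4 hL0'
        · rw [Int.abs_eq_natAbs, Nat.cast_le, hr]
          apply Nat.le_floor
          rw [Nat.cast_natAbs]
          push_cast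
          exact h1
      · intro h hh h' hh' heq
        simp only [Prod.mk.injEq] at heq
        obtain ⟨-, ⟨j, hj⟩, -⟩ := hX h (mem_coe.mp hh)
        obtain ⟨-, ⟨j', hj'⟩, -⟩ := hX h' (mem_coe.mp hh')
        have hL0' : (L : ℤ) ≠ 0 := by exact_mod_cast hL0.ne'
        have h1 := heq.1
        rw [hj, hj', Int.mul_ediv_cancel_left _ hL0', Int.mul_ediv_cancel_left _ hL0'] at h1
        have h2 := heq.2
        rw [hj, hj', h1] at h2
        linarith
    rw [card_product, Int.card_Icc, Int.card_Icc] at hcard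
    have e1 : ((J : ℤ) + 1 - -(J : ℤ)).toNat = 2 * J + 1 := by omega
    have e2 : ((r : ℤ) + 1 - -(r : ℤ)).toNat = 2 * r + 1 := by omega
    rw [e1, e2] at hcard
    have hr' : (r : ℝ) ≤ K / 2 := Nat.floor_le (by positivity)
    have hJ' : (1 : ℝ) ≤ J := by exact_mod_cast hJ1
    calc _ ≤ (((2 * J + 1) * (2 * r + 1) : ℕ) : ℝ) := by exact_mod_cast hcard
      _ = (2 * (J : ℝ) + 1) * (2 * r + 1) := by push_cast; ring
      _ ≤ (3 * J) * (K + 1) := by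
          apply mul_le_mul <;> first | positivity | linarith
      _ = _ := by rw [hJ]; push_cast; ring
  rw [← sum_fiberwise_of_maps_to hmaps]
  calc _ ≤ ∑ T ∈ P.powerset.erase ∅, 3 * (K + 1) * ∏ q ∈ T, (E * q) := by
        apply sum_le_sum
        intro T hT
        calc _ ≤ ∑ h ∈ H.filter (fun h => P \ D h = T), E ^ T.card := by
              apply sum_le_sum
              intro h hh
              obtain ⟨hhH, rfl⟩ := mem_filter.mp hh
              exact hf h hhH
          _ = ((H.filter (fun h => P \ D h = T)).card : ℝ) * E ^ T.card := by simp
          _ ≤ (3 * (K + 1) * ∏ q ∈ T, (q : ℝ)) * E ^ T.card := by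
              gcongr
              exact hcount T hT
          _ = _ := by rw [prod_mul_distrib, prod_const]; ring
    _ = _ := by
        rw [← mul_sum, prod_one_add, ← add_sum_erase _ _ (empty_mem_powerset P)]
        simp

/-- For `|h| ≤ K / 2 ≤ M / 2` the distance of `h / n` to the nearest integer is `|h| / n ≥ |h| / N`.
-/
theorem norm_prod_factor_le_exp_sq {p : ℝ} (A : Finset ℕ) (h : ℤ)
    {N M K κ : ℝ} (hM : 0 < M) (hκ : κ ≤ p * (1 - p)) (hκ0 : 0 ≤ κ)
    (hA : ∀ n ∈ A, M ≤ (n : ℝ) ∧ (n : ℝ) ≤ N) (hKM : K ≤ M) (hh : |(h : ℝ)| ≤ K / 2) :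
    ‖∏ n ∈ A, factor p ((2 * Real.pi * (h / n) : ℝ) * Complex.I)‖ ≤
      Real.exp (-(8 * κ * (|(h : ℝ)| / N) ^ 2 * A.card)) := by
  rw [norm_prod]
  calc _ ≤ ∏ n ∈ A, Real.exp (-(8 * κ * (|(h : ℝ)| / N) ^ 2)) := by
        refine prod_le_prod (fun _ _ => norm_nonneg _) fun n hn => ?_
        obtain ⟨h1, h2⟩ := hA n hn
        have hn0 : (0 : ℝ) < n := by linarith
        have hN0 : 0 < N := by linarith
        refine (norm_factor_le _).trans (Real.exp_le_exp.mpr (neg_le_neg ?_))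
        have h3 := eight_mul_sq_le_one_sub_cos (θ := (h : ℝ) / n) (ρ := |(h : ℝ)| / N)
          (by positivity) ?_
        · calc _ = κ * (8 * (|(h : ℝ)| / N) ^ 2) := by ring
            _ ≤ _ := mul_le_mul hκ h3 (by positivity) (hκ0.trans hκ)
        · intro j
          have h4 : |(h : ℝ)| / N ≤ |(h : ℝ) / n| := by
            rw [abs_div, abs_of_pos hn0]; gcongr
          have h5 : |(h : ℝ) / n| ≤ 1 / 2 := by
            rw [abs_div, abs_of_pos hn0, div_le_iff₀ hn0]; linarith
          rcases eq_or_ne j 0 with rfl | hj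
          · simpa using h4
          · have h6 : (1 : ℝ) ≤ |(j : ℝ)| := by
              exact_mod_cast Int.one_le_abs hj
            have h7 := abs_sub_abs_le_abs_sub (j : ℝ) ((h : ℝ) / n)
            rw [abs_sub_comm] at h7
            linarith
    _ = _ := by rw [prod_const, ← Real.exp_nat_mul]; congr 1; ring

/-! ### The circle method with explicit parameters -/

theorem dvd_Q {A : Finset ℕ} (h0 : 0 ∉ A) {n : ℕ} (hn : n ∈ A) : n ∣ Q A := by
  rw [Nat.dvd_iff_prime_pow_dvd_dvd]
  intro p k hp hd
  rcases Nat.eq_zero_or_pos k with rfl | hk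
  · simp
  · exact dvd_lcm (f := id) ((mem_primePowers h0 _).mpr
      ⟨(isPrimePow_nat_iff _).mpr ⟨p, k, hp, hk, rfl⟩, n, hn, hd⟩)

theorem Q_pos {A : Finset ℕ} (h0 : 0 ∉ A) : 0 < Q A := by
  refine Nat.pos_of_ne_zero ?_
  unfold Q
  rw [Ne, Finset.lcm_eq_zero_iff]
  rintro ⟨q, hq, h⟩
  exact ((mem_primePowers h0 q).mp hq).1.ne_zero h

/-- The frequencies `|h| ≤ K / 2`: the term `h = 0` is `1`, the terms with `|h| ≤ H₀` have
nonnegative real part, and the at most `K + 1` others add up to at most `1/4`. -/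
theorem re_sum_near_ge {p : ℝ} (hp0 : 0 ≤ p) (hp1 : p ≤ 1) (A : Finset ℕ)
    {N M K κ H₀ : ℝ} (hM : 0 < M) (hκ : κ ≤ p * (1 - p)) (hκ0 : 0 ≤ κ)
    (hA : ∀ n ∈ A, M ≤ (n : ℝ) ∧ (n : ℝ) ≤ N) (hN : 0 < N) (hK : 0 ≤ K) (hKM : K ≤ M) (hH : 0 ≤ H₀)
    (hH1 : 2 * Real.pi * H₀ / M ≤ 1) (hH2 : A.card * (2 * Real.pi * H₀ / M) ^ 3 ≤ 1 / 2)
    (hH3 : (K + 1) * Real.exp (-(8 * κ * (H₀ / N) ^ 2 * A.card)) ≤ 1 / 4)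
    (H : Finset ℤ) (h0 : 0 ∈ H) (hHK : ∀ h ∈ H, |(h : ℝ)| ≤ K / 2) :
    3 / 4 ≤ (∑ h ∈ H, ∏ n ∈ A, factor p ((2 * Real.pi * (h / n) : ℝ) * Complex.I)).re := by
  set ε := Real.exp (-(8 * κ * (H₀ / N) ^ 2 * A.card)) with hε
  rw [Complex.re_sum, ← add_sum_erase _ _ h0]
  have hF0 : (∏ n ∈ A, factor p ((2 * Real.pi * (((0 : ℤ) : ℝ) / n) : ℝ) * Complex.I)).re = 1 := by
    simp [factor]
  rw [hF0]
  have h1 : ∀ h ∈ H.erase 0, -ε ≤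
      (∏ n ∈ A, factor p ((2 * Real.pi * (h / n) : ℝ) * Complex.I)).re := by
    intro h hh
    have hhK := hHK h (mem_of_mem_erase hh)
    by_cases hhH : |(h : ℝ)| ≤ H₀
    · have := re_prod_factor_nonneg hp0 hp1 A (fun n => 2 * Real.pi * (h / n)) hH1 (fun n hn => by
        have hn0 : 0 < (n : ℝ) := hM.trans_le (hA n hn).1
        rw [abs_mul, abs_of_pos Real.two_pi_pos, abs_div, abs_of_pos hn0, mul_div_assoc]
        have := Real.pi_pos
        have := (hA n hn).1
        gcongr) hH2
      have hε0 : 0 < ε := Real.exp_pos _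
      linarith
    · push Not at hhH
      have h2 := norm_prod_factor_le_exp_sq (p := p) A h hM hκ hκ0 hA hKM hhK
      have h3 : Real.exp (-(8 * κ * (|(h : ℝ)| / N) ^ 2 * A.card)) ≤ ε := by
        rw [hε, Real.exp_le_exp, neg_le_neg_iff]
        gcongr
      have h4 := Complex.abs_re_le_norm
        (∏ n ∈ A, factor p ((2 * Real.pi * (h / n) : ℝ) * Complex.I))
      linarith [(abs_le.mp h4).1]
  have h2 : -((K + 1) * ε) ≤ ∑ h ∈ H.erase 0,
      (∏ n ∈ A, factor p ((2 * Real.pi * (h / n) : ℝ) * Complex.I)).re := by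
    calc -((K + 1) * ε) ≤ ∑ h ∈ H.erase 0, -ε := by
          rw [sum_const, nsmul_eq_mul, mul_neg, neg_le_neg_iff]
          have hcard : ((H.erase 0).card : ℝ) ≤ K + 1 := by
            have hsub : H.erase 0 ⊆ Icc (-(⌊K / 2⌋₊ : ℤ)) ⌊K / 2⌋₊ := by
              intro h hh
              rw [mem_Icc, ← abs_le, Int.abs_eq_natAbs, Nat.cast_le]
              apply Nat.le_floor
              rw [Nat.cast_natAbs]
              push_cast
              exact hHK h (mem_of_mem_erase hh)
            have h3 := card_le_card hsub
            rw [Int.card_Icc,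
              show ((⌊K / 2⌋₊ : ℤ) + 1 - -(⌊K / 2⌋₊ : ℤ)).toNat = 2 * ⌊K / 2⌋₊ + 1 by omega] at h3
            have h4 : (⌊K / 2⌋₊ : ℝ) ≤ K / 2 := Nat.floor_le (by positivity)
            calc _ ≤ ((2 * ⌊K / 2⌋₊ + 1 : ℕ) : ℝ) := by exact_mod_cast h3
              _ ≤ _ := by push_cast; linarith
          exact mul_le_mul_of_nonneg_right hcard (Real.exp_pos _).le
      _ ≤ _ := sum_le_sum h1
  linarith

open Classical in
/-- The frequencies `|h| > K / 2`. Here `D h` consists of the prime powers `q` with fewer than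
`η M / (2q)` elements of `A_q` that divide no integer near `h`; their reciprocals sum to at most
`η / (2q)`, so the other elements of `A_q` have reciprocal sum at least `η / (2q)`, as
`exists_common_multiple` requires. -/
theorem sum_far_le {p : ℝ} (hp0 : 0 ≤ p) (hp1 : p ≤ 1) (A : Finset ℕ) (I : ℕ)
    {N M S K T V k G η Y κ : ℝ} (hM : 0 < M) (hκ : κ ≤ p * (1 - p)) (hκ0 : 0 ≤ κ)
    (hA : ∀ n ∈ A, M ≤ (n : ℝ) ∧ (n : ℝ) ≤ N) (hS : ∀ n ∈ A, IsSmooth S n)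
    (hΩ : ∀ n ∈ A, (ArithmeticFunction.cardFactors n : ℝ) ≤ k)
    (hη : 0 < η) (hAη : ∀ q ∈ primePowers A, η ≤ (q : ℝ) * R (multiplesIn A q))
    (hNT : N = M * Real.exp T) (hT : 1 ≤ T) (hSM : S * Real.exp T ≤ M) (hSK : S ≤ K)
    (hK0 : 0 ≤ K) (hK : K ≤ M * Real.exp (-V)) (hKQ : K < Q A)
    (hk : 1 ≤ k) (hV : 2 * k ≤ V) (hVI : V ≤ 2 ^ I)
    (hY : 2 ≤ Y) (hKY : Real.log K ≤ Y)
    (hG : 0 ≤ G) (hGc : (I + 1) * (2304 * Real.exp 12 * k ^ 3 * G * T / V) < η / 2)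
    (hG2 : Real.exp 28 * (1 + V / (2 * k)) * (1 + Real.log Y) ≤ G ^ 2)
    (hE : 3 * (K + 1) * (Real.exp (Real.exp (-(2 * κ * (K / N) ^ 2 * (η * M / (2 * S) / k))) *
      N ^ 2) - 1) ≤ 1 / 4)
    (H : Finset ℤ) (hHQ : ∀ h ∈ H, |(h : ℝ)| ≤ Q A / 2) (hHK : ∀ h ∈ H, K / 2 < |(h : ℝ)|) :
    ∑ h ∈ H, ‖∏ n ∈ A, factor p ((2 * Real.pi * (h / n) : ℝ) * Complex.I)‖ ≤ 1 / 4 := by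
  have h0A : 0 ∉ A := fun h => by
    have := (hA 0 h).1
    simp at this; linarith
  have hN : 0 < N := by rw [hNT]; positivity
  set P := primePowers A with hP
  have hPq : ∀ q ∈ P, IsPrimePow q ∧ 0 < q ∧ (q : ℝ) ≤ S ∧ (q : ℝ) ≤ N := by
    intro q hq
    obtain ⟨h1, n, hn, h2⟩ := (mem_primePowers h0A q).mp hq
    have hn0 : 0 < n := Nat.pos_of_ne_zero fun h => h0A (h ▸ hn)
    exact ⟨h1, h1.pos, hS n hn q h1 h2,
      (Nat.cast_le.mpr (Nat.le_of_dvd hn0 h2)).trans (hA n hn).2⟩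
  set E := Real.exp (-(2 * κ * (K / N) ^ 2 * (η * M / (2 * S) / k))) with hEdef
  set D : ℤ → Finset ℕ := fun h => P.filter (fun q =>
    (((multiplesIn A q).filter (fun n => ¬ DividesNear K h n)).card : ℝ) < η * M / (2 * q)) with hD
  have hx : ∀ h ∈ H, ∃ x : ℤ, |(x : ℝ) - h| ≤ K / 2 ∧ (∀ q ∈ D h, (q : ℤ) ∣ x) := by
    intro h _
    refine exists_common_multiple A (D h) I h hM hA hΩ hNT hT hk hV hVI hK0 hK hY hKY hG hGc hG2 ?_
    intro q hq
    obtain ⟨hqP, hqc⟩ := mem_filter.mp hq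
    obtain ⟨-, h2, h3, -⟩ := hPq q hqP
    have hq0 : (0 : ℝ) < q := by exact_mod_cast h2
    refine ⟨h2, h3.trans hSK, ?_, ?_⟩
    · exact (mul_le_mul_of_nonneg_right h3 (Real.exp_pos _).le).trans hSM
    · have h4 := hAη q hqP
      unfold R at h4
      rw [← sum_filter_add_sum_filter_not _ (DividesNear K h), mul_add] at h4
      have h5 : q * ∑ n ∈ (multiplesIn A q).filter (fun n => ¬ DividesNear K h n), 1 / (n : ℝ) ≤
          η / 2 := by
        calc _ ≤ q * ∑ n ∈ (multiplesIn A q).filter (fun n => ¬ DividesNear K h n), 1 / M := by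
              gcongr with n hn
              exact (hA n (mem_filter.mp (mem_filter.mp hn).1).1).1
          _ ≤ q * (η * M / (2 * q) * (1 / M)) := by
              rw [sum_const, nsmul_eq_mul]
              gcongr
          _ = η / 2 := by field_simp
      linarith
  have hxQ : ∀ h ∈ H, ∀ x : ℤ, |(x : ℝ) - h| ≤ K / 2 → |(x : ℝ)| < Q A := by
    intro h hh x hxh
    have h1 := abs_le.mp hxh
    have h2 := abs_le.mp (hHQ h hh)
    rw [abs_lt]
    constructor <;> linarith
  have key := sum_minor_le P (fun q hq => (hPq q hq).2.1) H D
    (fun h => ‖∏ n ∈ A, factor p ((2 * Real.pi * (h / n) : ℝ) * Complex.I)‖)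
    (K := K) (E := E) hK0 (Real.exp_pos _).le ?_ ?_ ?_
  · refine key.trans (le_trans ?_ hE)
    have h1 : ∏ q ∈ P, (1 + E * q) ≤ Real.exp (E * N ^ 2) := by
      refine (Real.prod_one_add_le_exp_sum P (fun q => by positivity)).trans
        (Real.exp_le_exp.mpr ?_)
      rw [← mul_sum]
      gcongr
      have hcard : (P.card : ℝ) ≤ N := by
        have hsub : P ⊆ Icc 1 ⌊N⌋₊ := fun q hq => by
          rw [mem_Icc]
          exact ⟨(hPq q hq).2.1, Nat.le_floor (hPq q hq).2.2.2⟩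
        have := card_le_card hsub
        rw [Nat.card_Icc, Nat.add_sub_cancel] at this
        exact (Nat.cast_le.mpr this).trans (Nat.floor_le hN.le)
      calc ∑ q ∈ P, (q : ℝ) ≤ ∑ q ∈ P, N := sum_le_sum fun q hq => (hPq q hq).2.2.2
        _ = P.card * N := by simp
        _ ≤ N * N := by gcongr
        _ = N ^ 2 := by ring
    have h2 : 0 ≤ 3 * (K + 1) := by linarith
    exact mul_le_mul_of_nonneg_left (by linarith) h2
  · intro h hh
    rw [Finset.ssubset_iff_subset_ne]
    refine ⟨filter_subset _ _, fun heq => ?_⟩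
    obtain ⟨x, hx1, hx2⟩ := hx h hh
    -- If `D h` were all of `P`, then `Q ∣ x` and `|x| < Q`, so that `x = 0` and `|h| ≤ K / 2`.
    rw [heq] at hx2
    have h1 : (Q A : ℤ) ∣ x := by
      rw [Int.natCast_dvd]
      exact Finset.lcm_dvd fun q hq => Int.natCast_dvd.mp (hx2 q hq)
    have h2 : x = 0 := Int.eq_zero_of_abs_lt_dvd h1 (by
      have := hxQ h hh x hx1
      exact_mod_cast this)
    rw [h2] at hx1
    simp only [Int.cast_zero, zero_sub, abs_neg] at hx1
    linarith [hHK h hh]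
  · intro h hh
    refine norm_prod_factor_le hp0 hp1 A (P \ D h) h hN hK0 hκ hκ0 (by linarith) (fun n hn =>
      ⟨Nat.pos_of_ne_zero fun h => h0A (h ▸ hn), (hA n hn).2⟩) hΩ fun q hq => ?_
    obtain ⟨hqP, hqD⟩ := mem_sdiff.mp hq
    obtain ⟨h1, h2, h3, -⟩ := hPq q hqP
    have hq0 : (0 : ℝ) < q := by exact_mod_cast h2
    refine ⟨h1, ?_⟩
    have h4 : ¬ (_ < _) := fun h4 => hqD (mem_filter.mpr ⟨hqP, h4⟩)
    refine le_trans ?_ (not_lt.mp h4)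
    gcongr
  · intro h hh
    obtain ⟨x, hx1, hx2⟩ := hx h hh
    refine ⟨x, hx1, hx2, ?_⟩
    have := (hxQ h hh x hx1).le
    change |x| ≤ (Q A : ℕ)
    exact_mod_cast this

/-- The circle method: the conclusion holds for every choice of the parameters `T`, `V`, `k`, `G`,
`I`, `κ`, `H₀` satisfying the inequalities that the estimates of the two ranges of frequencies and
of the tail require. -/
theorem exists_subset_of_parameters {p : ℝ} (hp0 : 0 ≤ p) (hp1 : p ≤ 1) (A : Finset ℕ) (I x : ℕ)
    {N M S K T V k G η Y κ H₀ : ℝ} (hM : 0 < M) (hκ : κ ≤ p * (1 - p)) (hκ0 : 0 ≤ κ)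
    (hp : p * R A = x / Q A)
    (hA : ∀ n ∈ A, M ≤ (n : ℝ) ∧ (n : ℝ) ≤ N) (hS : ∀ n ∈ A, IsSmooth S n)
    (hΩ : ∀ n ∈ A, (ArithmeticFunction.cardFactors n : ℝ) ≤ k)
    (hη : 0 < η) (hAη : ∀ q ∈ primePowers A, η ≤ (q : ℝ) * R (multiplesIn A q))
    (hNT : N = M * Real.exp T) (hT : 1 ≤ T) (hSM : S * Real.exp T ≤ M) (hSK : S ≤ K)
    (hK0 : 0 ≤ K) (hK : K ≤ M * Real.exp (-V)) (hKQ : K < Q A)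
    (hk : 1 ≤ k) (hV : 2 * k ≤ V) (hVI : V ≤ 2 ^ I)
    (hY : 2 ≤ Y) (hKY : Real.log K ≤ Y)
    (hG : 0 ≤ G) (hGc : (I + 1) * (2304 * Real.exp 12 * k ^ 3 * G * T / V) < η / 2)
    (hG2 : Real.exp 28 * (1 + V / (2 * k)) * (1 + Real.log Y) ≤ G ^ 2)
    (hE : 3 * (K + 1) * (Real.exp (Real.exp (-(2 * κ * (K / N) ^ 2 * (η * M / (2 * S) / k))) *
      N ^ 2) - 1) ≤ 1 / 4)
    (hH : 0 ≤ H₀)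
    (hH1 : 2 * Real.pi * H₀ / M ≤ 1) (hH2 : A.card * (2 * Real.pi * H₀ / M) ^ 3 ≤ 1 / 2)
    (hH3 : (K + 1) * Real.exp (-(8 * κ * (H₀ / N) ^ 2 * A.card)) ≤ 1 / 4)
    (htail : Q A * (2 * Real.exp (-(M ^ 2 / (4 * N)))) < 1 / 2) :
    ∃ B : Finset ℕ, B ⊆ A ∧ R B = x / Q A := by
  have h0A : 0 ∉ A := fun h => by
    have := (hA 0 h).1
    simp at this; linarith
  have hN : 0 < N := by rw [hNT]; positivity
  have hMN : M ≤ N := by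
    rw [hNT]; exact le_mul_of_one_le_right hM.le (Real.one_le_exp (by linarith))
  have hQ := Q_pos h0A
  have hKM : K ≤ M := hK.trans
    (mul_le_of_le_one_right hM.le (Real.exp_le_one_iff.mpr (by linarith)))
  have hcard : (A.card : ℝ) ≤ N := by
    have hsub : A ⊆ Icc 1 ⌊N⌋₊ := fun n hn => by
      rw [mem_Icc]
      exact ⟨Nat.pos_of_ne_zero fun h => h0A (h ▸ hn), Nat.le_floor (hA n hn).2⟩
    have := card_le_card hsub
    rw [Nat.card_Icc, Nat.add_sub_cancel] at this
    exact (Nat.cast_le.mpr this).trans (Nat.floor_le hN.le)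
  refine exists_subset_of_fourier A hQ (fun n hn => dvd_Q h0A hn) hp0 hp1 x hp
    (-((Q A / 2 : ℕ) : ℤ)) ?_ ?_
  · set J := Ico (-((Q A / 2 : ℕ) : ℤ)) (-((Q A / 2 : ℕ) : ℤ) + (Q A : ℕ)) with hJ
    have hJQ : ∀ h ∈ J, |(h : ℝ)| ≤ Q A / 2 := by
      intro h hh
      rw [hJ, mem_Ico] at hh
      have h1 : -(Q A : ℤ) ≤ 2 * h := by omega
      have h2 : 2 * h ≤ (Q A : ℤ) := by omega
      have h1' : -(Q A : ℝ) ≤ 2 * h := by exact_mod_cast h1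
      have h2' : 2 * (h : ℝ) ≤ Q A := by exact_mod_cast h2
      rw [abs_le]; constructor <;> linarith
    rw [← sum_filter_add_sum_filter_not J (fun h : ℤ => |(h : ℝ)| ≤ K / 2), Complex.add_re]
    have h1 := re_sum_near_ge hp0 hp1 A hM hκ hκ0 hA hN hK0 hKM hH hH1 hH2 hH3
      (J.filter (fun h : ℤ => |(h : ℝ)| ≤ K / 2)) (by
        rw [mem_filter, hJ, mem_Ico]
        refine ⟨by omega, ?_⟩
        simp only [Int.cast_zero, abs_zero]; linarith) (fun h hh => (mem_filter.mp hh).2)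
    have h2 := sum_far_le hp0 hp1 A I hM hκ hκ0 hA hS hΩ hη hAη hNT hT hSM hSK hK0 hK hKQ hk hV hVI
      hY hKY hG hGc hG2 hE (J.filter (fun h : ℤ => ¬ |(h : ℝ)| ≤ K / 2))
      (fun h hh => hJQ h (mem_filter.mp hh).1) (fun h hh => not_le.mp (mem_filter.mp hh).2)
    have h3 := (Complex.abs_re_le_norm (∑ h ∈ J.filter (fun h : ℤ => ¬ |(h : ℝ)| ≤ K / 2),
      ∏ n ∈ A, factor p ((2 * Real.pi * (h / n) : ℝ) * Complex.I))).trans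
      ((norm_sum_le _ _).trans h2)
    linarith [(abs_le.mp h3).1]
  · refine lt_of_le_of_lt ?_ htail
    gcongr
    exact sum_weight_tail_le hp0 hp1 A hM hMN (fun n hn => (hA n hn).1) hcard

/-! ### Size of `Q`, `A` and `Γ` -/

open Filter in
/-- All the requirements that `N` be sufficiently large, in terms of `L = log N`. -/
theorem eventually_log_bounds {δ ε : ℝ} (hδ : δ < 1) (hε : 0 < ε) (c : ℝ) (hc : 0 < c) :
    ∃ L₀ : ℝ, ∀ L : ℝ, L₀ ≤ L → 3 ≤ L ∧ 1 ≤ Real.log L ∧ 10 * Real.log L ≤ L ^ (1 - δ) ∧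
      c * Real.log L ^ 9 ≤ L ^ (2 * ε) ∧ 140 * Real.log L ≤ L ∧
      40 * L * (L + 3) ≤ Real.exp (0.11 * L) ∧ L ≤ Real.exp (0.09 * L) := by
  rw [← eventually_atTop]
  have e1 : ∀ᶠ L : ℝ in atTop, 3 ≤ L := eventually_ge_atTop 3
  have e2 : ∀ᶠ L : ℝ in atTop, 1 ≤ Real.log L := Real.tendsto_log_atTop.eventually_ge_atTop 1
  have e3 := (isLittleO_log_rpow_atTop (show (0 : ℝ) < 1 - δ by linarith)).bound
    (show (0 : ℝ) < 1 / 10 by norm_num)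
  have e4 := (isLittleO_log_rpow_rpow_atTop (9 : ℝ) (show (0 : ℝ) < 2 * ε by linarith)).bound
    (show (0 : ℝ) < 1 / c by positivity)
  have e5 := (isLittleO_log_rpow_atTop (show (0 : ℝ) < 1 by norm_num)).bound
    (show (0 : ℝ) < 1 / 140 by norm_num)
  have e6 := (isLittleO_pow_exp_pos_mul_atTop 2 (show (0 : ℝ) < 0.11 by norm_num)).bound
    (show (0 : ℝ) < 1 / 80 by norm_num)
  have e7 := (isLittleO_pow_exp_pos_mul_atTop 1 (show (0 : ℝ) < 0.09 by norm_num)).bound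
    (show (0 : ℝ) < 1 by norm_num)
  filter_upwards [e1, e2, e3, e4, e5, e6, e7] with L h1 h2 h3 h4 h5 h6 h7
  have hL : 0 < L := by linarith
  have hl : 0 < Real.log L := by linarith
  rw [Real.norm_of_nonneg hl.le, Real.norm_of_nonneg (by positivity)] at h3 h5
  rw [Real.norm_of_nonneg (by positivity), Real.norm_of_nonneg (by positivity)] at h4 h6 h7
  rw [Real.rpow_one] at h5
  have h9 : Real.log L ^ (9 : ℝ) = Real.log L ^ 9 := by
    rw [← Real.rpow_natCast]; norm_num
  rw [h9] at h4
  refine ⟨h1, h2, by linarith, ?_, by linarith, ?_, by linarith [pow_one L]⟩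
  · rw [one_div_mul_eq_div, le_div_iff₀ hc] at h4; linarith
  · nlinarith

/-- By smoothness `Q` divides the least common multiple of the integers up to `S`, which is
`exp (ψ(S))`; Chebyshev's bound on `ψ` gives the claim. -/
theorem Q_le_exp {A : Finset ℕ} (h0 : 0 ∉ A) {S : ℝ} (hS0 : 0 ≤ S)
    (hS : ∀ n ∈ A, IsSmooth S n) : (Q A : ℝ) ≤ Real.exp (6 * S) := by
  have h1 : Q A ∣ Nat.lcmUpto ⌊S⌋₊ := by
    apply Finset.lcm_dvd
    intro q hq
    obtain ⟨hpp, n, hn, hd⟩ := (mem_primePowers h0 q).mp hq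
    exact dvd_lcm (f := id) (mem_Icc.mpr ⟨hpp.pos, Nat.le_floor (hS n hn q hpp hd)⟩)
  have h2 : (Q A : ℝ) ≤ Nat.lcmUpto ⌊S⌋₊ := by
    exact_mod_cast Nat.le_of_dvd (Nat.pos_of_ne_zero (Nat.lcmUpto_ne_zero _)) h1
  refine h2.trans ?_
  rw [← Real.log_le_iff_le_exp (by exact_mod_cast Nat.pos_of_ne_zero (Nat.lcmUpto_ne_zero _)),
    ← Chebyshev.psi_eq_log_lcmUpto, ← Chebyshev.psi_eq_psi_coe_floor]
  refine (Chebyshev.psi_le_const_mul_self hS0).trans ?_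
  have hl4 : Real.log 4 = 2 * Real.log 2 := by
    rw [show (4 : ℝ) = 2 ^ 2 by norm_num, Real.log_pow]; norm_num
  have := Real.log_two_lt_d9
  gcongr
  linarith

/-- The trivial upper bound for `q R(A_q)`, by the harmonic sum over `[M / q, N / q]`. It bounds `η`
in terms of `log (N / M)`. -/
theorem mul_R_multiplesIn_le (A : Finset ℕ) {q : ℕ} (hq : 0 < q) {M N T : ℝ}
    (hA : ∀ n ∈ A, M ≤ (n : ℝ) ∧ (n : ℝ) ≤ N) (hNT : N = M * Real.exp T) (hT : 0 ≤ T)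
    (hqM : q ≤ M) : q * R (multiplesIn A q) ≤ 3 * (T + 1) := by
  have hq0 : (0 : ℝ) < q := by exact_mod_cast hq
  have hdvd : ∀ n ∈ multiplesIn A q, q ∣ n := fun n hn => (mem_filter.mp hn).2
  have hsum : q * R (multiplesIn A q) =
      ∑ m ∈ (multiplesIn A q).image (fun n => n / q), 1 / (m : ℝ) := by
    unfold R
    rw [sum_image, mul_sum]
    · apply sum_congr rfl
      intro n hn
      obtain ⟨m, rfl⟩ := hdvd n hn
      rw [Nat.mul_div_cancel_left m hq]
      push_cast
      rcases eq_or_ne (m : ℝ) 0 with h | h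
      · simp [h]
      · field_simp
    · intro n hn n' hn' h
      simp only at h
      rw [← Nat.mul_div_cancel' (hdvd n hn), ← Nat.mul_div_cancel' (hdvd n' hn'), h]
  rw [hsum]
  apply sum_inv_le_of_mem_Icc (u := M / q) _ ((one_le_div hq0).mpr hqM) hT
  intro m hm
  obtain ⟨n, hn, rfl⟩ := mem_image.mp hm
  obtain ⟨m, rfl⟩ := hdvd n hn
  rw [Nat.mul_div_cancel_left m hq]
  have h1 := hA _ (mem_filter.mp hn).1
  push_cast at h1
  rw [div_le_iff₀ hq0, div_mul_eq_mul_div, le_div_iff₀ hq0, ← hNT]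
  constructor <;> linarith [h1.1, h1.2]

/-- A lower bound for `|A|`: an element of `A` exceeds `S`, so it is not prime, and its least prime
factor `q ≤ √N` satisfies `η ≤ q R(A_q) ≤ √N |A| / M`. -/
theorem card_ge (A : Finset ℕ) {M N S η : ℝ} (hM : 0 < M)
    (hA : ∀ n ∈ A, M ≤ (n : ℝ) ∧ (n : ℝ) ≤ N) (hS : ∀ n ∈ A, IsSmooth S n) (hSM : S < M)
    (hM1 : 1 < M) (hAη : ∀ q ∈ primePowers A, η ≤ (q : ℝ) * R (multiplesIn A q))
    (hne : A.Nonempty) : η * M ≤ √N * A.card := by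
  have h0A : 0 ∉ A := fun h => by
    have := (hA 0 h).1
    simp at this; linarith
  obtain ⟨n, hn⟩ := hne
  have hn1 : 1 < n := by
    have := hM1.trans_le (hA n hn).1
    exact_mod_cast this
  have hp := Nat.minFac_prime hn1.ne'
  set q := n.minFac with hq
  have hnp : ¬ n.Prime := fun h => by
    have h1 := hS n hn n h.isPrimePow dvd_rfl
    linarith [(hA n hn).1]
  have hq2 : q ^ 2 ≤ n := Nat.minFac_sq_le_self (by omega) hnp
  have hqN : (q : ℝ) ≤ √N := by
    apply Real.le_sqrt_of_sq_le
    refine le_trans ?_ (hA n hn).2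
    exact_mod_cast hq2
  have h1 := hAη q ((mem_primePowers h0A q).mpr ⟨hp.isPrimePow, n, hn, Nat.minFac_dvd n⟩)
  have h2 : R (multiplesIn A q) ≤ A.card * (1 / M) := by
    unfold R
    calc _ ≤ ∑ n ∈ A, 1 / (n : ℝ) :=
          sum_le_sum_of_subset_of_nonneg (filter_subset _ _) fun _ _ _ => by positivity
      _ ≤ ∑ n ∈ A, 1 / M := by
          gcongr with m hm
          exact (hA m hm).1
      _ = _ := by simp
  have h3 : η ≤ √N * (A.card * (1 / M)) := h1.trans (mul_le_mul hqN h2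
    (sum_nonneg fun _ _ => by positivity) (Real.sqrt_nonneg N))
  calc η * M ≤ √N * (A.card * (1 / M)) * M := by gcongr
    _ = _ := by field_simp

/-- Both terms in the maximum defining `Γ` are `O(η (log N)^(1-δ) / log (N / M))`; for the second
this uses `η ≪ log (N / M)`. -/
theorem Gam_le {δ η M N : ℝ} (hL : 1 ≤ Real.log N) (hℓ : 1 ≤ Real.log (Real.log N)) (hδ0 : 0 < δ)
    (hη : 0 ≤ η) (hT : 0 < Real.log (N / M)) (hTL : Real.log (N / M) ≤ Real.log N)
    (hηT : η ≤ 6 * Real.log (N / M)) :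
    Gam δ η M N ≤ 6 * (η * Real.log N ^ (1 - δ) / Real.log (N / M)) := by
  set L := Real.log N with hLdef
  set ℓ := Real.log L
  set T := Real.log (N / M)
  have hL0 : 0 < L := by linarith
  set V := L ^ (1 - δ) with hV
  have hV0 : 0 < V := by positivity
  have hVL : V ≤ L := by
    calc V ≤ L ^ (1 : ℝ) := Real.rpow_le_rpow_of_exponent_le hL (by linarith)
      _ = L := Real.rpow_one L
  have e1 : L ^ δ = L / V := by
    rw [hV, Real.rpow_sub hL0, Real.rpow_one]; field_simp
  have e2 : L ^ (1 - 2 * δ) = V ^ 2 / L := by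
    rw [hV, ← Real.rpow_natCast, ← Real.rpow_mul hL0.le, ← Real.rpow_sub_one hL0.ne']
    congr 1; push_cast; ring
  have hX : 0 ≤ η * V / T := by positivity
  unfold Gam
  rw [← hLdef, e1, e2]
  apply max_le
  · calc η / (L / V * ℓ ^ 3) ≤ η / (L / V * 1) := by
          gcongr
          exact one_le_pow₀ hℓ
      _ = η * V / L := by field_simp
      _ ≤ η * V / T := by gcongr
      _ ≤ _ := by linarith
  · calc η ^ 2 * (V ^ 2 / L) / (T ^ 2 * ℓ ^ 5) ≤ η ^ 2 * (V ^ 2 / L) / (T ^ 2 * 1) := by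
          gcongr
          exact one_le_pow₀ hℓ
      _ = (η * V / T) * (η / T * (V / L)) := by field_simp
      _ ≤ (η * V / T) * (6 * 1) := by
          gcongr
          · rwa [div_le_iff₀ hT]
          · rwa [div_le_one hL0]
      _ = _ := by ring

/-! ### Choice of the parameters -/

/-- The variance of the selection is bounded below on the allowed range of probabilities. -/
theorem le_mul_one_sub {p L : ℝ} (hL : 1 ≤ L) (h1 : 1 / L ≤ p) (h2 : (1 + 1 / L) * p ≤ 1) :
    1 / (4 * L) ≤ p * (1 - p) := by
  have hL0 : 0 < L := by linarith
  have h3 : (1 + 1 / L) * p = p + p / L := by ring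
  have hp0 : 0 < p := lt_of_lt_of_le (by positivity) h1
  rw [h3] at h2
  have e : 1 / (4 * L) = 1 / L / 4 := by field_simp
  rw [e]
  rcases le_total p (1 / 2) with h | h
  · nlinarith
  · have h4 : 1 / L / 2 ≤ p / L := by
      rw [div_div, mul_comm, ← div_div]; gcongr
    nlinarith

/-- The bound on `S` makes the exponent at least `L² / (20 ℓ) ≥ 3 L + 4`, where `ℓ` stands for `log
L`. This beats the factors `K + 1 ≤ 2N` and `N²`. -/
theorem minor_arc_error_le {κ L ℓ N M S K η : ℝ} (hL : 3 ≤ L) (hℓ : 1 ≤ ℓ) (hℓL : 140 * ℓ ≤ L)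
    (hN : N = Real.exp L) (hM : 0 < M) (hS : 0 < S) (hη : 0 < η)
    (hKN : K ≤ N) (hκ : κ = 1 / (4 * L))
    (hSb : S ≤ η * M * K ^ 2 / (N ^ 2 * L ^ 3)) :
    3 * (K + 1) * (Real.exp (Real.exp (-(2 * κ * (K / N) ^ 2 * (η * M / (2 * S) / (5 * ℓ)))) *
      N ^ 2) - 1) ≤ 1 / 4 := by
  have hN0 : 0 < N := by rw [hN]; positivity
  have hL0 : 0 < L := by linarith
  have h1 : L ^ 3 ≤ η * M * K ^ 2 / (N ^ 2 * S) := by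
    rw [le_div_iff₀ (by positivity)] at hSb ⊢
    linarith
  have h2 : 2 * κ * (K / N) ^ 2 * (η * M / (2 * S) / (5 * ℓ)) =
      η * M * K ^ 2 / (N ^ 2 * S) / (20 * L * ℓ) := by
    rw [hκ]; field_simp; ring
  have h3 : 3 * L + 4 ≤ 2 * κ * (K / N) ^ 2 * (η * M / (2 * S) / (5 * ℓ)) := by
    rw [h2]
    refine le_trans ?_ (div_le_div_of_nonneg_right h1 (by positivity))
    rw [le_div_iff₀ (by positivity)]
    have h4 : (3 * L + 4) * ℓ * 20 ≤ L * L := by nlinarith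
    calc (3 * L + 4) * (20 * L * ℓ) = ((3 * L + 4) * ℓ * 20) * L := by ring
      _ ≤ L * L * L := by gcongr
      _ = L ^ 3 := by ring
  set X := 2 * κ * (K / N) ^ 2 * (η * M / (2 * S) / (5 * ℓ))
  have h5 : Real.exp (-X) * N ^ 2 ≤ Real.exp (-(L + 4)) := by
    calc _ ≤ Real.exp (-(3 * L + 4)) * N ^ 2 := by gcongr
      _ = Real.exp (-(L + 4)) := by
        rw [hN, ← Real.exp_nat_mul, ← Real.exp_add]; congr 1; push_cast; ring
  set y := Real.exp (-X) * N ^ 2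
  have hy0 : 0 ≤ y := by positivity
  have h6 : Real.exp (-(L + 4)) = Real.exp (-4) / N := by
    rw [hN, ← Real.exp_sub]; congr 1; ring
  have h48 : Real.exp (-4) ≤ 1 / 48 := by
    rw [Real.exp_neg, ← one_div]
    apply one_div_le_one_div_of_le (by norm_num)
    have h7 : Real.exp 4 = Real.exp 1 ^ 4 := by rw [← Real.exp_nat_mul]; norm_num
    rw [h7]
    calc (48 : ℝ) ≤ 2.7 ^ 4 := by norm_num
      _ ≤ _ := by gcongr; linarith [Real.exp_one_gt_d9]
  have hN1 : 1 ≤ N := by rw [hN]; exact Real.one_le_exp hL0.le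
  have h8 : y ≤ 1 / 48 / N := by rw [h6] at h5; exact h5.trans (by gcongr)
  have hy1 : y ≤ 1 := h8.trans (by rw [div_le_iff₀ hN0]; linarith)
  have h9 : Real.exp y - 1 ≤ 2 * y := by
    have := (abs_le.mp (Real.abs_exp_sub_one_sub_id_le (by rwa [abs_of_nonneg hy0]))).2
    nlinarith
  calc _ ≤ 3 * (N + N) * (2 * (1 / 48 / N)) := by
        have h10 : 0 ≤ Real.exp y - 1 := by linarith [Real.one_le_exp hy0]
        apply mul_le_mul (by linarith) (by linarith) h10 (by linarith)
    _ = 1 / 4 := by field_simp; norm_num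

/-- The radius `H₀ = M / (2π (2a)^(1/3))`, with `a` in the role of `|A|`: up to it the phases add up
to a bounded angle, and from it on the Gaussian decay `exp (-8κ (H₀ / N)² a)` is at most
`1 / (8N)`, as `a^(1/3)` is a power of `N` larger than `(N / M)²`. -/
theorem exists_major_arc_radius {κ L N M K a : ℝ} (hL : 3 ≤ L)
    (hLe : 40 * L * (L + 3) ≤ Real.exp (0.11 * L)) (hN : N = Real.exp L)
    (hM : Real.exp (0.99 * L) ≤ M) (hKN : K ≤ N) (hκ : κ = 1 / (4 * L))
    (ha : Real.exp (0.4 * L) ≤ a) :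
    ∃ H₀ : ℝ, 0 ≤ H₀ ∧ 2 * Real.pi * H₀ / M ≤ 1 ∧ a * (2 * Real.pi * H₀ / M) ^ 3 ≤ 1 / 2 ∧
      (K + 1) * Real.exp (-(8 * κ * (H₀ / N) ^ 2 * a)) ≤ 1 / 4 := by
  have hL0 : 0 < L := by linarith
  have hN0 : 0 < N := by rw [hN]; positivity
  have hM0 : 0 < M := lt_of_lt_of_le (Real.exp_pos _) hM
  have ha0 : 0 < a := lt_of_lt_of_le (Real.exp_pos _) ha
  have ha1 : 1 ≤ a := (Real.one_le_exp (by positivity)).trans ha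
  have hπ := Real.pi_pos
  set s := (2 * a) ^ ((1 : ℝ) / 3) with hs
  have hs0 : 0 < s := by positivity
  have hs3 : s ^ 3 = 2 * a := by
    rw [hs, ← Real.rpow_natCast, ← Real.rpow_mul (by positivity)]; norm_num
  have hs1 : 1 ≤ s := Real.one_le_rpow (by linarith) (by norm_num)
  have hsL : Real.exp (0.13 * L) ≤ s := by
    calc Real.exp (0.13 * L) ≤ Real.exp (0.4 * L) ^ ((1 : ℝ) / 3) := by
          rw [← Real.exp_mul, Real.exp_le_exp]; linarith
      _ ≤ s := by
          rw [hs]; gcongr; linarith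
  have hH : 2 * Real.pi * (M / (2 * Real.pi * s)) / M = 1 / s := by field_simp
  refine ⟨M / (2 * Real.pi * s), by positivity, ?_, ?_, ?_⟩
  · rw [hH, div_le_one hs0]; exact hs1
  · rw [hH, div_pow, hs3, one_pow]
    apply le_of_eq; field_simp
  · have h1 : 8 * κ * (M / (2 * Real.pi * s) / N) ^ 2 * a =
        (M / N) ^ 2 * s / (4 * Real.pi ^ 2 * L) := by
      have : a = s ^ 3 / 2 := by rw [hs3]; ring
      rw [hκ, this]; field_simp; ring
    have h2 : Real.exp (-(0.02 * L)) ≤ (M / N) ^ 2 := by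
      have : Real.exp (-(0.01 * L)) ≤ M / N := by
        rw [le_div_iff₀ hN0, hN, ← Real.exp_add]
        refine le_trans (le_of_eq ?_) hM
        congr 1; ring
      calc _ = Real.exp (-(0.01 * L)) ^ 2 := by
            rw [← Real.exp_nat_mul]; congr 1; push_cast; ring
        _ ≤ _ := by gcongr
    have h3 : L + 3 ≤ 8 * κ * (M / (2 * Real.pi * s) / N) ^ 2 * a := by
      rw [h1, le_div_iff₀ (by positivity)]
      calc (L + 3) * (4 * Real.pi ^ 2 * L) ≤ (L + 3) * (4 * 10 * L) := by
            have : Real.pi ^ 2 ≤ 10 := by nlinarith [Real.pi_lt_d2]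
            gcongr
        _ = 40 * L * (L + 3) := by ring
        _ ≤ Real.exp (0.11 * L) := hLe
        _ = Real.exp (-(0.02 * L)) * Real.exp (0.13 * L) := by
            rw [← Real.exp_add]; congr 1; ring
        _ ≤ _ := by gcongr
    have hN1 : 1 ≤ N := by rw [hN]; exact Real.one_le_exp hL0.le
    have h8 : Real.exp (-3) ≤ 1 / 8 := by
      rw [Real.exp_neg, ← one_div]
      apply one_div_le_one_div_of_le (by norm_num)
      have h7 : Real.exp 3 = Real.exp 1 ^ 3 := by rw [← Real.exp_nat_mul]; norm_num
      rw [h7]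
      calc (8 : ℝ) ≤ 2.7 ^ 3 := by norm_num
        _ ≤ _ := by gcongr; linarith [Real.exp_one_gt_d9]
    calc _ ≤ (N + N) * Real.exp (-(L + 3)) := by gcongr
      _ = 2 * Real.exp (-3) := by
          rw [neg_add, Real.exp_add, Real.exp_neg L, ← hN]; field_simp; norm_num
      _ ≤ 1 / 4 := by linarith

/-- The threshold `G = η V / (c₁ ℓ⁴ T)`, with `ℓ = log L`, is small enough for the divisor bound of
`sum_inv_divisors_le` to stay below `η / 2`. By the hypothesis on `Γ ≤ 6 η V / T` it is also large
enough for `G²` to exceed `O(V log L)`, the bound for the weights of two distinct integers. -/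
theorem exists_weight_threshold {L V T η Γ ε : ℝ} (hL3 : 3 ≤ L) (hℓ1 : 1 ≤ Real.log L)
    (hℓV : 10 * Real.log L ≤ V) (hVL : V ≤ L) (hη0 : 0 < η) (hT0 : 0 < T) (hΓ0 : 0 ≤ Γ)
    (hΓle : Γ ≤ 6 * (η * V / T)) (hΓ : 100 ≤ Γ ^ 2 / (L ^ (2 * ε) * (T + V)))
    (hℓε : 144 * Real.exp 28 * (2304 * Real.exp 12 * 2000) ^ 2 * Real.log L ^ 9 ≤ L ^ (2 * ε)) :
    ∃ (I : ℕ) (G : ℝ), 0 ≤ G ∧ V ≤ 2 ^ I ∧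
      (I + 1) * (2304 * Real.exp 12 * (5 * Real.log L) ^ 3 * G * T / V) < η / 2 ∧
      Real.exp 28 * (1 + V / (2 * (5 * Real.log L))) * (1 + Real.log L) ≤ G ^ 2 := by
  set ℓ := Real.log L with hℓ
  have hL0 : 0 < L := by linarith
  have hℓ0 : 0 < ℓ := by linarith
  have hV0 : 0 < V := by linarith
  set c₁ : ℝ := 2304 * Real.exp 12 * 2000 with hc₁
  have hc₁0 : 0 < c₁ := by positivity
  set G := η * V / (c₁ * ℓ ^ 4 * T) with hG
  have hG0 : 0 ≤ G := by positivity
  have hG2 : Real.exp 28 * (1 + V / (2 * (5 * ℓ))) * (1 + Real.log L) ≤ G ^ 2 := by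
    rw [le_div_iff₀ (by positivity)] at hΓ
    have h1 : Γ ≤ 6 * c₁ * ℓ ^ 4 * G := by
      refine hΓle.trans (le_of_eq ?_)
      rw [hG]; field_simp
    have h2 : L ^ (2 * ε) * V ≤ 36 * c₁ ^ 2 * ℓ ^ 8 * G ^ 2 := by
      have h3 : 0 ≤ L ^ (2 * ε) := by positivity
      calc L ^ (2 * ε) * V ≤ 100 * (L ^ (2 * ε) * (T + V)) := by
            nlinarith [mul_nonneg h3 hT0.le, mul_nonneg h3 hV0.le]
        _ ≤ Γ ^ 2 := hΓ
        _ ≤ (6 * c₁ * ℓ ^ 4 * G) ^ 2 := by gcongr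
        _ = _ := by ring
    have h4 : (144 * Real.exp 28 * c₁ ^ 2 * ℓ ^ 9) * V ≤ 36 * c₁ ^ 2 * ℓ ^ 8 * G ^ 2 :=
      le_trans (by gcongr) h2
    have h5 : 36 * c₁ ^ 2 * ℓ ^ 8 * (4 * Real.exp 28 * ℓ * V) ≤ 36 * c₁ ^ 2 * ℓ ^ 8 * G ^ 2 := by
      refine le_trans (le_of_eq ?_) h4; ring
    refine le_trans ?_ (le_of_mul_le_mul_left h5 (by positivity))
    have h6 : V / (2 * (5 * ℓ)) ≤ V := div_le_self hV0.le (by linarith)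
    have hV1 : 1 ≤ V := by linarith
    calc _ ≤ Real.exp 28 * (V + V) * (ℓ + ℓ) := by gcongr
      _ = _ := by ring
  set I := ⌈2 * ℓ⌉₊ with hI
  have hI1 : (I : ℝ) + 1 ≤ 4 * ℓ := by
    have := Nat.ceil_lt_add_one (by positivity : 0 ≤ 2 * ℓ)
    linarith
  have hVI : V ≤ 2 ^ I := by
    refine hVL.trans ?_
    rw [← Real.log_le_log_iff hL0 (by positivity), Real.log_pow]
    have h1 : 2 * ℓ ≤ I := Nat.le_ceil _
    nlinarith [Real.log_two_gt_d9]
  have hGc : (I + 1) * (2304 * Real.exp 12 * (5 * ℓ) ^ 3 * G * T / V) < η / 2 := by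
    calc _ ≤ (4 * ℓ) * (2304 * Real.exp 12 * (5 * ℓ) ^ 3 * G * T / V) := by gcongr
      _ = η / 4 := by rw [hG, hc₁]; field_simp; norm_num
      _ < _ := by linarith
  exact ⟨I, G, hG0, hVI, hGc, hG2⟩

/-- `A` has at least `N^0.4` elements. -/
theorem exp_le_card (A : Finset ℕ) {L M N S η : ℝ} (hNL : N = Real.exp L) (hL0 : 0 < L)
    (hLe' : L ≤ Real.exp (0.09 * L)) (hη : L⁻¹ ≤ η) (hM99 : Real.exp (0.99 * L) ≤ M)
    (hM0 : 0 < M)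
    (hA : ∀ n ∈ A, M ≤ (n : ℝ) ∧ (n : ℝ) ≤ N) (hAS : ∀ n ∈ A, IsSmooth S n) (hSM' : S < M)
    (hM1 : 1 < M) (hAη : ∀ q ∈ primePowers A, η ≤ (q : ℝ) * R (multiplesIn A q))
    (hne : A.Nonempty) : Real.exp (0.4 * L) ≤ A.card := by
  have hη0 : 0 ≤ η := le_trans (by positivity) hη
  have h1 := card_ge A hM0 hA hAS hSM' hM1 hAη hne
  have h2 : √N = Real.exp (0.5 * L) := by
    rw [hNL, Real.sqrt_eq_rpow, ← Real.exp_mul]; congr 1; ring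
  have h3 : Real.exp (0.9 * L) ≤ η * M := by
    calc Real.exp (0.9 * L) = Real.exp (0.99 * L) / Real.exp (0.09 * L) := by
          rw [← Real.exp_sub]; congr 1; ring
      _ ≤ Real.exp (0.99 * L) / L := by gcongr
      _ = L⁻¹ * Real.exp (0.99 * L) := by ring
      _ ≤ _ := by gcongr
  have h4 : Real.exp (0.5 * L) * Real.exp (0.4 * L) ≤ Real.exp (0.5 * L) * A.card := by
    rw [← Real.exp_add, ← h2]
    refine le_trans (le_of_eq ?_) (h3.trans h1)
    congr 1; ring
  exact le_of_mul_le_mul_left h4 (Real.exp_pos _)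

/-- The tail probability is smaller than `1 / (2Q)`, since `Q ≤ exp (6S)` and `25 S ≤ M² / (4N)`. -/
theorem tail_lt {A : Finset ℕ} (h0A : 0 ∉ A) {N M S : ℝ} (hN0 : 0 < N) (hS1 : 1 ≤ S)
    (hSb1 : S ≤ M ^ 2 / (100 * N)) (hAS : ∀ n ∈ A, IsSmooth S n) :
    Q A * (2 * Real.exp (-(M ^ 2 / (4 * N)))) < 1 / 2 := by
  have h1 := Q_le_exp h0A (by linarith) hAS
  have h2 : 25 * S ≤ M ^ 2 / (4 * N) := by
    rw [le_div_iff₀ (by positivity)] at hSb1 ⊢; linarith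
  calc Q A * (2 * Real.exp (-(M ^ 2 / (4 * N)))) ≤
        Real.exp (6 * S) * (2 * Real.exp (-(25 * S))) := by gcongr
    _ = 2 * Real.exp (-(19 * S)) := by
        rw [mul_left_comm, ← Real.exp_add]; congr 2; ring
    _ ≤ 2 * Real.exp (-3) := by gcongr; linarith
    _ < 1 / 2 := by
        have h3 : Real.exp 3 = Real.exp 1 ^ 3 := by rw [← Real.exp_nat_mul]; norm_num
        have h4 : (8 : ℝ) < Real.exp 3 := by
          rw [h3]
          calc (8 : ℝ) < 2.7 ^ 3 := by norm_num
            _ ≤ _ := by gcongr; linarith [Real.exp_one_gt_d9]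
        rw [Real.exp_neg, ← div_eq_mul_inv, div_lt_div_iff₀ (Real.exp_pos _) (by norm_num)]
        linarith

end UnitFractions

open UnitFractions Finset in
theorem proposition5p2 :
    ∃ C : ℝ, 1 ≤ C ∧
      ∀ δ ε : ℝ, 0 < δ → δ < 1 → 0 < ε → ε < 1 / 10 →
      ∃ N₀ : ℝ, ∀ N : ℝ, N₀ ≤ N →
      ∀ η S K M : ℝ,
        (Real.log N)⁻¹ ≤ η →
        N ^ (0.99 : ℝ) ≤ S → S ≤ K → K ≤ M → M ≤ N / 10 ^ 4 →
        S ≤ min (M ^ 2 / (C * N)) (η * M * K ^ 2 / (N ^ 2 * Real.log N ^ 3)) →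
        K ≤ M * Real.exp (-(Real.log N ^ (1 - δ))) →
        C ≤ UnitFractions.Gam δ η M N ^ 2 /
              (Real.log N ^ (2 * ε) * (Real.log (N / M) + Real.log N ^ (1 - δ))) →
      ∀ A : Finset ℕ,
        (∀ n ∈ A, M ≤ (n : ℝ) ∧ (n : ℝ) ≤ N) →
        (∀ n ∈ A, UnitFractions.IsSmooth S n) →
        (∀ n ∈ A, (ArithmeticFunction.cardFactors n : ℝ) ≤ 5 * Real.log (Real.log N)) →
        (∀ q ∈ UnitFractions.primePowers A,
          η ≤ (q : ℝ) * UnitFractions.R (UnitFractions.multiplesIn A q)) →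
      ∀ x : ℕ,
        (1 + 1 / Real.log N) * ((x : ℝ) / (UnitFractions.Q A : ℝ)) ≤ UnitFractions.R A →
        UnitFractions.R A ≤ Real.log N * ((x : ℝ) / (UnitFractions.Q A : ℝ)) →
        ∃ B : Finset ℕ, B ⊆ A ∧ UnitFractions.R B = (x : ℝ) / (UnitFractions.Q A : ℝ) := by
  refine ⟨100, by norm_num, fun δ ε hδ0 hδ1 hε0 _ => ?_⟩
  obtain ⟨L₀, hL₀⟩ := eventually_log_bounds hδ1 hε0
    (144 * Real.exp 28 * (2304 * Real.exp 12 * 2000) ^ 2) (by positivity)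
  refine ⟨Real.exp L₀, fun N hN η S K M hη hS hSK hKM hMN hSmin hKV hΓ A hA hAS hΩ hAη
    x hx1 hx2 => ?_⟩
  have hN0 : 0 < N := (Real.exp_pos _).trans_le hN
  set L := Real.log N with hL
  obtain ⟨hL3, hℓ1, hℓV, hℓε, hℓL, hLe, hLe'⟩ := hL₀ L (by
    rw [hL, Real.le_log_iff_exp_le hN0]; exact hN)
  set ℓ := Real.log L with hℓ
  set V := L ^ (1 - δ) with hV
  have hL0 : 0 < L := by linarith
  have hNL : N = Real.exp L := (Real.exp_log hN0).symm
  have hS99 : Real.exp (0.99 * L) ≤ S := by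
    rw [Real.rpow_def_of_pos hN0, ← hL, mul_comm] at hS; exact hS
  have hS1 : 1 < S := lt_of_lt_of_le (Real.one_lt_exp_iff.mpr (by positivity)) hS99
  have hM99 : Real.exp (0.99 * L) ≤ M := hS99.trans (hSK.trans hKM)
  have hM1 : 1 < M := lt_of_lt_of_le hS1 (hSK.trans hKM)
  have hM0 : 0 < M := by linarith
  have hη0 : 0 < η := lt_of_lt_of_le (by positivity) hη
  have hV0 : 0 < V := by positivity
  have hVL : V ≤ L := by
    calc V ≤ L ^ (1 : ℝ) := Real.rpow_le_rpow_of_exponent_le (by linarith) (by linarith)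
      _ = L := Real.rpow_one L
  set T := Real.log (N / M) with hT
  have hNM : 10 ^ 4 ≤ N / M := by rw [le_div_iff₀ hM0]; linarith
  have hTe : Real.exp T = N / M := Real.exp_log (by positivity)
  have hNT : N = M * Real.exp T := by rw [hTe]; field_simp
  have hT1 : 1 ≤ T := by
    rw [hT, Real.le_log_iff_exp_le (by positivity)]
    linarith [Real.exp_one_lt_d9]
  have hTL : T ≤ L := Real.log_le_log (by positivity) (div_le_self hN0.le hM1.le)
  obtain ⟨hSb1, hSb2⟩ := le_min_iff.mp hSmin
  have hSM : S * Real.exp T ≤ M / 100 := by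
    rw [hTe]
    calc S * (N / M) ≤ M ^ 2 / (100 * N) * (N / M) := by gcongr
      _ = M / 100 := by field_simp
  have hSM' : S < M := by
    have := Real.one_le_exp (by linarith : 0 ≤ T)
    nlinarith
  have hKltM : K < M := lt_of_le_of_lt hKV (mul_lt_of_lt_one_right hM0
    (by rw [← Real.exp_zero, Real.exp_lt_exp]; linarith))
  have hKN : K ≤ N := by
    rw [hNT]; exact hKM.trans (le_mul_of_one_le_right hM0.le (Real.one_le_exp (by linarith)))
  have h0A : 0 ∉ A := fun h => by
    have := (hA 0 h).1
    simp at this; linarith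
  -- If `A` is empty, then `R(A) = 0` forces `x = 0`.
  rcases A.eq_empty_or_nonempty with rfl | hne
  · refine ⟨∅, subset_rfl, ?_⟩
    have hR0 : R ∅ = 0 := by simp [R]
    rw [hR0] at hx1 ⊢
    have h1 : 0 ≤ (x : ℝ) / (Q ∅ : ℝ) := by positivity
    have h2 : 0 < 1 + 1 / L := by positivity
    exact le_antisymm h1 (le_of_mul_le_mul_left (by rw [mul_zero]; exact hx1) h2)
  have hQ0 := Q_pos h0A
  obtain ⟨n₀, hn₀⟩ := id hne
  have hn₀M := (hA n₀ hn₀).1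
  have hn₀1 : 1 < n₀ := by
    have := hM1.trans_le hn₀M
    exact_mod_cast this
  have hKQ : K < Q A := by
    refine hKltM.trans_le (hn₀M.trans ?_)
    exact_mod_cast Nat.le_of_dvd hQ0 (dvd_Q h0A hn₀)
  have hRpos : 0 < R A := by
    unfold R
    refine sum_pos (fun n hn => ?_) hne
    have : 0 < (n : ℝ) := hM0.trans_le (hA n hn).1
    positivity
  -- The least prime factor of any element of `A` shows that `η ≤ 6 T`; hence `Γ ≤ 6 η V / T`.
  have hηT : η ≤ 6 * T := by
    have hp := Nat.minFac_prime hn₀1.ne'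
    have hmem := (mem_primePowers h0A n₀.minFac).mpr ⟨hp.isPrimePow, n₀, hn₀, Nat.minFac_dvd n₀⟩
    have h1 := hAη _ hmem
    have h2 := hAS n₀ hn₀ _ hp.isPrimePow (Nat.minFac_dvd n₀)
    have h3 := mul_R_multiplesIn_le A hp.pos hA hNT (by linarith) (h2.trans hSM'.le)
    linarith
  have hΓle := Gam_le (by linarith : 1 ≤ Real.log N) hℓ1 hδ0 hη0.le (by linarith) hTL hηT
  have hΓ0 : 0 ≤ Gam δ η M N := by
    unfold Gam
    refine le_max_of_le_left ?_
    have : 0 < Real.log (Real.log N) := by linarith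
    positivity
  have hV10 : 10 * ℓ ≤ V := hℓV
  obtain ⟨I, G, hG0, hVI, hGc, hG2⟩ := exists_weight_threshold (Γ := Gam δ η M N) (ε := ε) hL3 hℓ1
    hV10 hVL hη0 (by linarith : 0 < T) hΓ0 hΓle hΓ hℓε
  -- With selection probability `p`, the random sum `R(B)` has mean `p R(A) = x / Q`.
  set p := (x : ℝ) / Q A / R A with hp
  have hpR : p * R A = x / Q A := by rw [hp]; field_simp
  have hp0 : 0 ≤ p := by positivity
  have hpL : 1 / L ≤ p := by
    rw [hp, div_le_div_iff₀ hL0 hRpos]; linarith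
  have hpL' : (1 + 1 / L) * p ≤ 1 := by
    rw [hp, mul_div_assoc', div_le_one hRpos]; exact hx1
  have hp1 : p ≤ 1 := by
    have : 0 ≤ 1 / L * p := by positivity
    linarith
  have hκ := le_mul_one_sub (by linarith) hpL hpL'
  have hcard := exp_le_card A hNL (by linarith) hLe' hη hM99 hM0 hA hAS hSM' hM1 hAη hne
  obtain ⟨H₀, hH0, hH1, hH2, hH3⟩ := exists_major_arc_radius hL3 hLe hNL hM99 hKN rfl hcard
  have htail := tail_lt h0A hN0 (by linarith) hSb1 hAS
  exact exists_subset_of_parameters hp0 hp1 A I x (κ := 1 / (4 * L)) (Y := L) hM0 hκ (by positivity)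
    hpR hA hAS hΩ hη0 hAη hNT hT1 (by linarith) hSK (by linarith) hKV hKQ (by linarith)
    (by linarith) hVI (by linarith) (Real.log_le_log (by linarith) hKN) hG0 hGc hG2
    (minor_arc_error_le hL3 hℓ1 hℓL hNL hM0 (by linarith) hη0 hKN rfl hSb2)
    hH0 hH1 hH2 hH3 htail
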